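/- A $(\beta,\varepsilon)$-hopset of a directed graph $G=(V,E)$ with non-negative edge weights is a set $H\subseteq V\times V$ of additional directed edges with non-negative weights such that for all $u,v\in V$: (1) $\mathrm{dist}_{G}(u,v)=\mathrm{dist}_{G\cup H}(u,v)$, where $\mathrm{dist}$ is the weighted distance ($\infty$ if $v$ is not reachable from $u$); and (2) if $u$ can reach $v$ in $G$, then $G\cup H$ contains a path from $u$ to $v$ with at most $\beta$ edges and weight at most $(1+\varepsilon)\,\mathrm{dist}_G(u,v)$. Theorem. There is an absolute constant $C>0$ such that the following holds for every directed graph $G$ on $n$ vertices whose edge weights are integers in $[1,W]$ (with $W\ge 1$ an integer) and every $\varepsilon\in(0,1)$. (a) For every real $\beta\ge 20\log n$ there is a $(\beta,\varepsilon)$-hopset $H$ of $G$ with $$|H|\le\begin{cases} C\,\dfrac{n^2\log^7 n\,\log^2(nW)}{\varepsilon^2\beta^3} & \text{if }\beta\le n^{1/3},\\[2ex] C\,\dfrac{n^{3/2}\log^7 n\,\log^2(nW)}{\varepsilon^2\beta^{3/2}} & \text{if }\beta> n^{1/3}.\end{cases}$$ (b) In particular, for $\beta=C\,n^{1/3}\log^{14/3}n\,\log^{4/3}(nW)\,\varepsilon^{-4/3}$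 (which is $\tilde O(n^{1/3})$ for fixed $\varepsilon$ and $W$ polynomial in $n$) there is a $(\beta,\varepsilon)$-hopset of $G$ with at most $Cn$ edges. Here $\log$ is the natural logarithm. -/

import Mathlib

open scoped ENNReal

/-- A directed graph on `V` with non-negative real edge weights: `weight u v` is the weight of the
edge from `u` to `v`, and `weight u v = ⊤` means that there is no such edge. -/
structure WeightedDigraph (V : Type*) where
  weight : V → V → ℝ≥0∞

namespace WeightedDigraph

/-- There is an edge from `u` to `v`. -/
def Adj {V : Type*} (G : WeightedDigraph V) (u v : V) : Prop :=
  G.weight u v ≠ ⊤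

/-- The set `E ⊆ V × V` of edges. -/
def edgeSet {V : Type*} (G : WeightedDigraph V) : Set (V × V) :=
  {e | G.Adj e.1 e.2}

/-- All edge weights are integers in `[1, W]`. -/
def HasIntegerWeights {V : Type*} (G : WeightedDigraph V) (W : ℕ) : Prop :=
  ∀ u v : V, G.Adj u v → ∃ k : ℕ, 1 ≤ k ∧ k ≤ W ∧ G.weight u v = (k : ℝ≥0∞)

/-- The graph `G ∪ H`. Of two parallel edges, one in `G` and one in `H`, the lighter is kept. -/
def union {V : Type*} (G H : WeightedDigraph V) : WeightedDigraph V where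
  weight u v := min (G.weight u v) (H.weight u v)

/-- Directed walks. As weights are non-negative, a walk can always be cut down to a simple path
with no more edges and no larger weight. -/
inductive Walk {V : Type*} (G : WeightedDigraph V) : V → V → Type _
  | nil (u : V) : Walk G u u
  | cons {u v w : V} (h : G.Adj u v) (p : Walk G v w) : Walk G u w

/-- The number of edges of a walk. -/
def Walk.hops {V : Type*} {G : WeightedDigraph V} : {u v : V} → G.Walk u v → ℕ
  | _, _, .nil _ => 0
  | _, _, .cons _ p => p.hops + 1

/-- The weight of a walk: the sum of the weights of its edges. -/
noncomputable def Walk.length {V : Type*} {G : WeightedDigraph V} :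
    {u v : V} → G.Walk u v → ℝ≥0∞
  | _, _, .nil _ => 0
  | _, _, .cons (u := u) (v := v) _ p => G.weight u v + p.length

/-- `u` can reach `v`. -/
def Reachable {V : Type*} (G : WeightedDigraph V) (u v : V) : Prop :=
  Nonempty (G.Walk u v)

/-- The weighted distance from `u` to `v`; it is `⊤` if `u` cannot reach `v`. -/
noncomputable def dist {V : Type*} (G : WeightedDigraph V) (u v : V) : ℝ≥0∞ :=
  ⨅ p : G.Walk u v, p.length

/-- `H` is a `(β, ε)`-hopset of `G`: adding `H` does not change any distance, and whenever `u` can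
reach `v` there is a path from `u` to `v` in `G ∪ H` with at most `β` edges and of weight at most
`(1 + ε) dist(u, v)`. -/
def IsHopset {V : Type*} (G H : WeightedDigraph V) (β ε : ℝ) : Prop :=
  (∀ u v : V, G.dist u v = (G.union H).dist u v) ∧
  ∀ u v : V, G.Reachable u v →
    ∃ p : (G.union H).Walk u v,
      (p.hops : ℝ) ≤ β ∧ p.length ≤ ENNReal.ofReal (1 + ε) * G.dist u v

end WeightedDigraph

/-! The edges of `G` enter only through the quasi-metric `G.dist` and the edges realizing it, so a
hopset becomes a set of extra links, each weighted by distance. Such links never change distances;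
what remains is to bound links and error.

The combinatorial core is `exists_hub_or_exists_spread_pair`. Take a geodesic chain with fewest
links, about `m` of them, for each of `B` pairs on `n` points. Either one chain meets a fraction
`m²/n` of the others, or one pair of points, added as a link, saves about `Bm/(n log m)` links in
total. This is a double count of incidences of two chains at a common point. Few of them lie in
small intersections if no chain is a hub. In a large intersection some second common point is far
away in one of the two chains, and one chain gains by a jump at least a constant times the distance
in the other; the harmonic sum of inverse distances along a chain costs only a logarithm.

Iterating the dichotomy (`exists_chains_and_links_of_minHops`) yields `Õ(n/m²)` chains and `Õ(n)`
links, after which each pair joined by `4m` links needs only `m` or meets a stored chain. Descending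
dyadically from `n` to about `β` links (`exists_routes`), every geodesic becomes a short chain
preceded by `O(log n)` visits to stored chains. A visit costs few hops: `Õ(n/β)` points hit every
geodesic early, and from each of them `Õ(1/ε)` entries into every stored chain preserve distances up
to a small fraction of the scale (`IsGeodesicChain.exists_entries`). The entries number
`Õ((n/β)(n/β²)/ε)`, which is the `n²/β³` term. Doubling the distance scale turns additive into
relative error and costs a factor `log (nW)` (`exists_links`).

For `β > n^(1/3)` the additive `Õ(n)` would dominate. The construction is then run on a sample of
about `n/b` points, with stretches of `b` links as its basic links; the optimal `b` gives
`(n/β)^(3/2)`. Part (b) is the choice of `β` that brings this down to `O(n)`. -/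

/-! ### Quasi-metrics and geodesic chains. -/

/-- A quasi-metric that separates points. -/
structure IsQuasiMetric {α : Type*} (d : α → α → ℝ≥0∞) : Prop where
  self : ∀ x, d x x = 0
  triangle : ∀ x y z, d x z ≤ d x y + d y z
  eq_of_eq_zero : ∀ x y, d x y = 0 → x = y

/-- `Geo d A k x y`: there is a chain of exactly `k` links of `A` from `x` to `y` whose total
`d`-length is finite and equal to `d x y`. -/
inductive Geo {α : Type*} (d : α → α → ℝ≥0∞) (A : Set (α × α)) : ℕ → α → α → Prop
  | nil (x : α) : Geo d A 0 x x
  | cons {k : ℕ} {x y z : α} (h : (x, y) ∈ A) (hfin : d x y ≠ ⊤) (hadd : d x y + d y z = d x z)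
      (p : Geo d A k y z) : Geo d A (k + 1) x z

/-- A geodesic chain of at most `k` links. -/
def GeoLE {α : Type*} (d : α → α → ℝ≥0∞) (A : Set (α × α)) (k : ℕ) (x y : α) : Prop :=
  ∃ j ≤ k, Geo d A j x y

section Geo

variable {α : Type*} {d : α → α → ℝ≥0∞} {A A' : Set (α × α)}

theorem IsQuasiMetric.between_right (hd : IsQuasiMetric d) {x w y z : α} (hw : d x w ≠ ⊤)
    (h₁ : d x w + d w y = d x y) (h₂ : d x y + d y z = d x z) : d w y + d y z = d w z := by
  refine le_antisymm ?_ (hd.triangle _ _ _)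
  have h := hd.triangle x w z
  rw [← h₂, ← h₁, add_assoc] at h
  exact (ENNReal.add_le_add_iff_left hw).1 h

theorem IsQuasiMetric.between_left (hd : IsQuasiMetric d) {x w y z : α}
    (h₁ : d x w + d w z = d x z) (h₂ : d w y + d y z = d w z) : d x y + d y z = d x z := by
  refine le_antisymm ?_ (hd.triangle _ _ _)
  calc d x y + d y z ≤ (d x w + d w y) + d y z := by gcongr; exact hd.triangle _ _ _
    _ = d x z := by rw [add_assoc, h₂, h₁]

theorem Geo.ne_top (hd : IsQuasiMetric d) {k : ℕ} {x y : α} (h : Geo d A k x y) : d x y ≠ ⊤ := by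
  induction h with
  | nil x => simp [hd.self]
  | cons h hfin hadd p ih => rw [← hadd]; exact ENNReal.add_ne_top.2 ⟨hfin, ih⟩

theorem Geo.mono (hA : A ⊆ A') {k : ℕ} {x y : α} (h : Geo d A k x y) : Geo d A' k x y := by
  induction h with
  | nil x => exact .nil x
  | cons h hfin hadd p ih => exact .cons (hA h) hfin hadd ih

theorem GeoLE.mono (hA : A ⊆ A') {k l : ℕ} (hkl : k ≤ l) {x y : α} (h : GeoLE d A k x y) :
    GeoLE d A' l x y := by
  obtain ⟨j, hj, h⟩ := h
  exact ⟨j, hj.trans hkl, h.mono hA⟩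

theorem Geo.append (hd : IsQuasiMetric d) {k l : ℕ} {x y z : α} (h₁ : Geo d A k x y)
    (h₂ : Geo d A l y z) (h : d x y + d y z = d x z) : Geo d A (k + l) x z := by
  induction h₁ with
  | nil x => simpa using h₂
  | cons hA hfin hadd p ih =>
    have h' := hd.between_right hfin hadd h
    rw [Nat.add_right_comm]
    refine .cons hA hfin ?_ (ih h₂ h')
    rw [← h', ← add_assoc, hadd, h]

theorem GeoLE.append (hd : IsQuasiMetric d) {k l : ℕ} {x y z : α} (h₁ : GeoLE d A k x y)
    (h₂ : GeoLE d A l y z) (h : d x y + d y z = d x z) : GeoLE d A (k + l) x z := by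
  obtain ⟨i, hi, h₁⟩ := h₁
  obtain ⟨j, hj, h₂⟩ := h₂
  exact ⟨i + j, by omega, h₁.append hd h₂ h⟩

theorem Geo.single (hd : IsQuasiMetric d) {x y : α} (h : (x, y) ∈ A) (hfin : d x y ≠ ⊤) :
    Geo d A 1 x y :=
  .cons h hfin (by simp [hd.self]) (.nil y)

/-- The inductive definition only records additivity towards the endpoint. Cancelling the finite
distance to the endpoint spreads it to all triples along the chain. -/
theorem Geo.exists_seq (hd : IsQuasiMetric d) {k : ℕ} {x y : α} (h : Geo d A k x y) :
    ∃ p : ℕ → α, p 0 = x ∧ p k = y ∧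
      (∀ i j, i ≤ j → j ≤ k → Geo d A (j - i) (p i) (p j)) ∧
      ∀ i j l, i ≤ j → j ≤ l → l ≤ k → d (p i) (p j) + d (p j) (p l) = d (p i) (p l) := by
  induction h with
  | nil x =>
    refine ⟨fun _ => x, rfl, rfl, fun i j hi hj => ?_, fun i j l _ _ _ => by simp [hd.self]⟩
    obtain rfl : j = 0 := by omega
    simpa using Geo.nil x
  | @cons k x y z hA hfin hadd hp ih =>
    obtain ⟨p, hp0, hpk, hgeo, hsum⟩ := ih
    have key : ∀ j, j ≤ k → d x y + d y (p j) = d x (p j) := by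
      intro j hj
      have h₁ := hsum 0 j k (Nat.zero_le _) hj le_rfl
      rw [hp0, hpk] at h₁
      refine le_antisymm ?_ (hd.triangle _ _ _)
      have hfin' : d (p j) z ≠ ⊤ := by
        have := (hgeo j k hj le_rfl).ne_top hd
        rwa [hpk] at this
      have h₂ := hd.triangle x (p j) z
      rw [← hadd, ← h₁, ← add_assoc] at h₂
      exact (ENNReal.add_le_add_iff_right hfin').1 h₂
    refine ⟨fun i => Nat.casesOn i x p, rfl, hpk, ?_, ?_⟩
    · rintro (_ | i) (_ | j) hij hj
      · simpa using Geo.nil x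
      · have hg := hgeo 0 j (Nat.zero_le _) (by omega)
        rw [hp0] at hg
        exact .cons hA hfin (key j (by omega)) hg
      · omega
      · simpa using hgeo i j (by omega) (by omega)
    · rintro (_ | i) (_ | j) (_ | l) hij hjl hl
      · simp [hd.self]
      · simp [hd.self]
      · omega
      · have h₁ := key j (by omega)
        have h₂ := key l (by omega)
        have h₃ := hsum 0 j l (Nat.zero_le _) (by omega) (by omega)
        rw [hp0] at h₃
        change d x (p j) + d (p j) (p l) = d x (p l)
        rw [← h₁, ← h₂, ← h₃, add_assoc]
      · omega
      · omega
      · omega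
      · exact hsum i j l (by omega) (by omega) (by omega)

/-- A finite set of points that lie, in some order, on a geodesic of length at most `L`. -/
def IsGeodesicChain (d : α → α → ℝ≥0∞) (L : ℝ) (X : Finset α) : Prop :=
  ∃ t : α → ℝ, (∀ x ∈ X, 0 ≤ t x ∧ t x ≤ L) ∧
    ∀ x ∈ X, ∀ y ∈ X, t x ≤ t y → d x y = ENNReal.ofReal (t y - t x)

/-- The data of a geodesic chain with the least possible number `k` of links: its vertices `X`
and their positions. -/
structure IsShortestVia (d : α → α → ℝ≥0∞) (A : Set (α × α)) (u v : α) (k : ℕ)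
    (X : Finset α) (pos : α → ℕ) : Prop where
  card : X.card = k + 1
  pos_le : ∀ x ∈ X, pos x ≤ k
  pos_inj : Set.InjOn pos X
  geo : ∀ x ∈ X, ∀ y ∈ X, pos x ≤ pos y → Geo d A (pos y - pos x) x y
  between : ∀ x ∈ X, ∀ y ∈ X, pos x ≤ pos y → d u x + d x y = d u y
  geo_left : ∀ x ∈ X, Geo d A (pos x) u x
  geo_right : ∀ x ∈ X, Geo d A (k - pos x) x v
  between_ends : ∀ x ∈ X, d u x + d x v = d u v
  minimal : ∀ j < k, ¬ Geo d A j u v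
  exists_pos : ∀ i ≤ k, ∃ x ∈ X, pos x = i

theorem GeoLE.exists_shortest (hd : IsQuasiMetric d) {M : ℕ} {u v : α} (h : GeoLE d A M u v) :
    ∃ k ≤ M, ∃ X pos, IsShortestVia d A u v k X pos := by
  classical
  obtain ⟨j, hj, hjG⟩ := h
  have hex : ∃ k, Geo d A k u v := ⟨j, hjG⟩
  set k := Nat.find hex with hk
  have hkG : Geo d A k u v := Nat.find_spec hex
  have hmin : ∀ i < k, ¬ Geo d A i u v := fun i hi => Nat.find_min hex hi
  obtain ⟨p, hp0, hpk, hgeo, hsum⟩ := hkG.exists_seq hd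
  have hinj : ∀ i j, i < j → j ≤ k → p i ≠ p j := by
    intro i j hij hjk heq
    have h₁ := hgeo 0 i (Nat.zero_le _) (by omega)
    have h₂ := hgeo j k hjk le_rfl
    rw [← heq] at h₂
    -- A repeated vertex bounds a loop; cutting it out leaves a geodesic chain with fewer links.
    have h₃ := h₁.append hd h₂ (hsum 0 i k (Nat.zero_le _) (by omega) le_rfl)
    rw [hp0, hpk] at h₃
    exact hmin _ (by omega) h₃
  have hinjOn : Set.InjOn p (Finset.range (k + 1)) := by
    intro i hi j hj heq
    simp only [Finset.coe_range, Set.mem_Iio] at hi hj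
    rcases lt_trichotomy i j with h | h | h
    · exact absurd heq (hinj i j h (by omega))
    · exact h
    · exact absurd heq.symm (hinj j i h (by omega))
  set X := (Finset.range (k + 1)).image p with hX
  have hpos : ∀ x, ∃ i, x ∈ X → i ≤ k ∧ p i = x := by
    intro x
    by_cases hx : x ∈ X
    · obtain ⟨i, hi, rfl⟩ := Finset.mem_image.1 hx
      exact ⟨i, fun _ => ⟨by simpa [Nat.lt_succ_iff] using hi, rfl⟩⟩
    · exact ⟨0, fun h => absurd h hx⟩
  choose pos hpos using hpos
  refine ⟨k, (Nat.find_min' hex hjG).trans hj, X, pos, ?_⟩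
  refine ⟨?_, fun x hx => (hpos x hx).1, ?_, ?_, ?_, ?_, ?_, ?_, hmin, ?_⟩
  · rw [hX, Finset.card_image_of_injOn hinjOn, Finset.card_range]
  · intro x hx y hy hxy
    rw [← (hpos x hx).2, ← (hpos y hy).2, hxy]
  · intro x hx y hy hxy
    have := hgeo _ _ hxy (hpos y hy).1
    rwa [(hpos x hx).2, (hpos y hy).2] at this
  · intro x hx y hy hxy
    have := hsum 0 _ _ (Nat.zero_le _) hxy (hpos y hy).1
    rwa [(hpos x hx).2, (hpos y hy).2, hp0] at this
  · intro x hx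
    have := hgeo 0 _ (Nat.zero_le _) (hpos x hx).1
    rwa [(hpos x hx).2, hp0] at this
  · intro x hx
    have := hgeo _ k (hpos x hx).1 le_rfl
    rwa [(hpos x hx).2, hpk] at this
  · intro x hx
    have := hsum 0 _ k (Nat.zero_le _) (hpos x hx).1 le_rfl
    rwa [(hpos x hx).2, hp0, hpk] at this
  · intro i hi
    have hmem : p i ∈ X := Finset.mem_image_of_mem _ (by simpa [Nat.lt_succ_iff] using hi)
    refine ⟨p i, hmem, ?_⟩
    exact hinjOn (by simpa [Nat.lt_succ_iff] using (hpos _ hmem).1)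
      (by simpa [Nat.lt_succ_iff] using hi) (hpos _ hmem).2

/-- The coordinate of a vertex is its distance from `u`. -/
theorem IsShortestVia.isGeodesicChain (hd : IsQuasiMetric d) {u v : α} {k : ℕ} {X : Finset α}
    {pos : α → ℕ} (h : IsShortestVia d A u v k X pos) {L : ℝ} (h0 : 0 ≤ L)
    (hL : d u v ≤ ENNReal.ofReal L) :
    IsGeodesicChain d L X := by
  have hL0 : d u v ≠ ⊤ := ne_top_of_le_ne_top ENNReal.ofReal_ne_top hL
  have hfin : ∀ x ∈ X, d u x ≠ ⊤ := fun x hx => (h.geo_left x hx).ne_top hd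
  have key : ∀ x ∈ X, ∀ y ∈ X, pos x ≤ pos y →
      d x y = ENNReal.ofReal ((d u y).toReal - (d u x).toReal) := by
    intro x hx y hy hxy
    have hb := h.between x hx y hy hxy
    have hxy' : d x y ≠ ⊤ := (h.geo x hx y hy hxy).ne_top hd
    rw [← hb, ENNReal.toReal_add (hfin x hx) hxy', add_sub_cancel_left, ENNReal.ofReal_toReal hxy']
  refine ⟨fun x => (d u x).toReal, fun x hx => ⟨ENNReal.toReal_nonneg, ?_⟩, ?_⟩
  · have hle : d u x ≤ ENNReal.ofReal L :=
      le_trans (by rw [← h.between_ends x hx]; exact le_self_add) hL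
    exact ENNReal.toReal_le_of_le_ofReal h0 hle
  · intro x hx y hy hxy
    rcases le_total (pos x) (pos y) with hp | hp
    · exact key x hx y hy hp
    -- The orders by position and by coordinate can disagree only for points at distance zero, which
    -- coincide.
    · have hyx := key y hy x hx hp
      rw [ENNReal.ofReal_of_nonpos (by linarith)] at hyx
      obtain rfl := hd.eq_of_eq_zero _ _ hyx
      simp [hd.self]

end Geo

/-! ### Overlapping chains: a hub or a profitable link. -/

section Overlap

variable {α ι : Type*}

/-- On either side of `x` the distances are distinct integers in `[1, m]`, so each side sums to at
most a harmonic number. -/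
theorem sum_one_div_dist_le [DecidableEq α] {X : Finset α} {pos : α → ℕ} {m : ℕ} (hinj : Set.InjOn pos X)
    (hle : ∀ x ∈ X, pos x ≤ m) {x : α} (hx : x ∈ X) :
    ∑ y ∈ X.erase x, 1 / |(pos x : ℝ) - pos y| ≤ 2 * (1 + Real.log m) := by
  have hharm : ∑ j ∈ Finset.Icc 1 m, (1 : ℝ) / j ≤ 1 + Real.log m := by
    have h := harmonic_le_one_add_log m
    rw [harmonic_eq_sum_Icc] at h
    push_cast at h
    simpa [one_div] using h
  have main : ∀ (F : Finset α) (g : α → ℕ), Set.InjOn g F → (∀ y ∈ F, 1 ≤ g y ∧ g y ≤ m) →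
      ∑ y ∈ F, (1 : ℝ) / g y ≤ 1 + Real.log m := by
    intro F g hg hF
    refine le_trans ?_ hharm
    rw [← Finset.sum_image (f := fun j : ℕ => (1 : ℝ) / j) hg]
    refine Finset.sum_le_sum_of_subset_of_nonneg ?_ fun _ _ _ => by positivity
    intro j hj
    obtain ⟨y, hy, rfl⟩ := Finset.mem_image.1 hj
    exact Finset.mem_Icc.2 (hF y hy)
  rw [← Finset.sum_filter_add_sum_filter_not _ (fun y => pos y < pos x), two_mul]
  have hne : ∀ y ∈ X.erase x, pos y ≠ pos x := fun y hy h =>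
    (Finset.mem_erase.1 hy).1 (hinj (Finset.mem_of_mem_erase hy) hx h)
  refine add_le_add ?_ ?_
  · refine le_trans (le_of_eq (Finset.sum_congr rfl fun y hy => ?_))
      (main _ (fun y => pos x - pos y) ?_ ?_)
    · rw [Nat.cast_sub (Finset.mem_filter.1 hy).2.le, abs_of_nonneg]
      have := (Finset.mem_filter.1 hy).2
      rw [sub_nonneg]; exact_mod_cast this.le
    · intro y hy z hz h
      simp only [Finset.coe_filter, Finset.mem_erase, Set.mem_ofPred_eq] at hy hz h
      exact hinj hy.1.2 hz.1.2 (by omega)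
    · intro y hy
      simp only [Finset.mem_filter, Finset.mem_erase] at hy
      have := hle x hx
      omega
  · refine le_trans (le_of_eq (Finset.sum_congr rfl fun y hy => ?_))
      (main _ (fun y => pos y - pos x) ?_ ?_)
    · have h := not_lt.1 (Finset.mem_filter.1 hy).2
      rw [Nat.cast_sub h, abs_sub_comm, abs_of_nonneg]
      rw [sub_nonneg]; exact_mod_cast h
    · intro y hy z hz h
      simp only [Finset.coe_filter, Finset.mem_erase, Set.mem_ofPred_eq] at hy hz h
      exact hinj hy.1.2 hz.1.2 (by omega)
    · intro y hy
      have h1 := hne y (Finset.mem_filter.1 hy).1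
      simp only [Finset.mem_filter, Finset.mem_erase] at hy
      have := hle y hy.1.2
      omega

theorem one_le_abs_sub_of_injOn {X : Finset α} {pos : α → ℕ} (hinj : Set.InjOn pos X) {x y : α}
    (hx : x ∈ X) (hy : y ∈ X) (hxy : y ≠ x) : (1 : ℝ) ≤ |(pos x : ℝ) - pos y| := by
  have h : (pos x : ℤ) - pos y ≠ 0 := fun h => hxy (hinj hy hx (by omega))
  have h1 := Int.one_le_abs h
  exact_mod_cast h1

/-- Only three integers lie within distance one of `pos x`. This is why intersections of at most
three points are treated separately. -/
theorem exists_two_le_abs_sub {X : Finset α} {pos : α → ℕ} (hinj : Set.InjOn pos X)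
    (hX : 4 ≤ X.card) (x : α) : ∃ y ∈ X, (2 : ℝ) ≤ |(pos x : ℝ) - pos y| := by
  by_contra! hcon
  have hsub : X.image pos ⊆ Finset.Icc (pos x - 1) (pos x + 1) := by
    intro j hj
    obtain ⟨y, hy, rfl⟩ := Finset.mem_image.1 hj
    have h := hcon y hy
    have h' : |(pos x : ℤ) - pos y| < 2 := by exact_mod_cast h
    rw [abs_lt] at h'
    rw [Finset.mem_Icc]
    omega
  have hc := Finset.card_le_card hsub
  rw [Finset.card_image_of_injOn hinj, Nat.card_Icc] at hc
  omega

/-- At one far `y`, the larger of the two distances is at least `2`; reduced by one it is still at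
least half of itself, hence at least half of the smaller distance. -/
theorem half_le_sum_ratio [DecidableEq α] {X Y : Finset α} {p q : α → ℕ} (hp : Set.InjOn p X)
    (hq : Set.InjOn q Y) (hXY : 4 ≤ (X ∩ Y).card) {x : α} (hx : x ∈ X ∩ Y) :
    1 / 2 ≤ ∑ y ∈ (X ∩ Y).erase x, (|(p x : ℝ) - p y| - 1) / |(q x : ℝ) - q y| +
      ∑ y ∈ (X ∩ Y).erase x, (|(q x : ℝ) - q y| - 1) / |(p x : ℝ) - p y| := by
  have hpI : Set.InjOn p (X ∩ Y : Finset α) := hp.mono (by simp)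
  have hqI : Set.InjOn q (X ∩ Y : Finset α) := hq.mono (by simp)
  obtain ⟨y, hy, hy2⟩ := exists_two_le_abs_sub hpI hXY x
  have hyx : y ≠ x := by rintro rfl; norm_num at hy2
  have hy1 := one_le_abs_sub_of_injOn hqI hx hy hyx
  rw [← Finset.sum_add_distrib]
  have hnn : ∀ z ∈ (X ∩ Y).erase x, 0 ≤ (|(p x : ℝ) - p z| - 1) / |(q x : ℝ) - q z| +
      (|(q x : ℝ) - q z| - 1) / |(p x : ℝ) - p z| := by
    intro z hz
    obtain ⟨hzx, hz⟩ := Finset.mem_erase.1 hz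
    have h1 := one_le_abs_sub_of_injOn hpI hx hz hzx
    have h2 := one_le_abs_sub_of_injOn hqI hx hz hzx
    have := div_nonneg (sub_nonneg.2 h1) (abs_nonneg ((q x : ℝ) - q z))
    have := div_nonneg (sub_nonneg.2 h2) (abs_nonneg ((p x : ℝ) - p z))
    linarith
  refine le_trans ?_ (Finset.single_le_sum hnn (Finset.mem_erase.2 ⟨hyx, hy⟩))
  generalize |(p x : ℝ) - p y| = a at *
  generalize |(q x : ℝ) - q y| = b at *
  have ha0 : 0 < a := by linarith
  have hb0 : 0 < b := by linarith
  have e1 : 0 ≤ (a - 1) / b := div_nonneg (by linarith) hb0.le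
  have e2 : 0 ≤ (b - 1) / a := div_nonneg (by linarith) ha0.le
  rcases le_total b a with h | h
  · have : 1 / 2 ≤ (a - 1) / b := by rw [le_div_iff₀ hb0]; linarith
    linarith
  · have : 1 / 2 ≤ (b - 1) / a := by rw [le_div_iff₀ ha0]; linarith
    linarith

/-- In a finite family of injectively positioned sets, either some member meets a large fraction
of the others or some pair of points is spread out, on average, in the members containing it. -/
theorem exists_hub_or_exists_spread_pair [Fintype α] [DecidableEq α] (F : Finset ι) (hF : F.Nonempty)
    (X : ι → Finset α) (pos : ι → α → ℕ) {m₁ m₂ : ℕ} (hm₁ : 0 < m₁)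
    (hcard : ∀ b ∈ F, m₁ ≤ (X b).card) (hinj : ∀ b ∈ F, Set.InjOn (pos b) (X b))
    (hpos : ∀ b ∈ F, ∀ x ∈ X b, pos b x ≤ m₂) :
    (∃ b' ∈ F, (m₁ : ℝ) ^ 2 / (24 * Fintype.card α) * F.card ≤
        (F.filter fun b => (X b ∩ X b').Nonempty).card) ∨
      ∃ x y : α, x ≠ y ∧ F.card * m₁ / (64 * Fintype.card α * (1 + Real.log m₂)) ≤
        ∑ b ∈ F.filter (fun b => x ∈ X b ∧ y ∈ X b), (|(pos b x : ℝ) - pos b y| - 1) := by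
  by_contra! hcon
  obtain ⟨hhub, hgain⟩ := hcon
  obtain ⟨b₀, hb₀⟩ := hF
  have hn : 0 < Fintype.card α := by
    obtain ⟨x, -⟩ := Finset.card_pos.1 (hm₁.trans_le (hcard b₀ hb₀))
    exact Fintype.card_pos_iff.2 ⟨x⟩
  have hB : 0 < F.card := Finset.card_pos.2 ⟨b₀, hb₀⟩
  have hH : 0 < 1 + Real.log m₂ := by
    have := Real.log_natCast_nonneg m₂
    linarith
  set n : ℝ := (Fintype.card α : ℝ) with hndef
  set B : ℝ := (F.card : ℝ) with hBdef
  set H : ℝ := 1 + Real.log m₂ with hHdef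
  have hn' : 0 < n := by rw [hndef]; exact_mod_cast hn
  have hB' : 0 < B := by rw [hBdef]; exact_mod_cast hB
  have hm' : (0 : ℝ) < m₁ := by exact_mod_cast hm₁
  set μ : α → ℝ := fun x => (F.filter fun b => x ∈ X b).card with hμ
  -- Half of the guaranteed average multiplicity: dropping the points below `τ` loses at most half
  -- of `B * m₁`.
  set τ : ℝ := B * m₁ / (2 * n) with hτ
  have hτ0 : 0 < τ := by positivity
  set Hi : Finset α := Finset.univ.filter fun x => τ ≤ μ x with hHi
  have hμpos : ∀ x ∈ Hi, 0 < μ x := fun x hx => hτ0.trans_le (Finset.mem_filter.1 hx).2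
  have hHicard : (Hi.card : ℝ) ≤ n := by
    rw [hndef]; exact_mod_cast Finset.card_le_univ Hi
  have hsumμ : B * m₁ ≤ ∑ x, μ x := by
    have h1 : ∑ x, μ x = ∑ b ∈ F, ((X b).card : ℝ) := by
      have : ∀ x, μ x = ∑ b ∈ F, if x ∈ X b then (1 : ℝ) else 0 := by
        intro x; simp [hμ]
      simp_rw [this]
      rw [Finset.sum_comm]
      refine Finset.sum_congr rfl fun b _ => ?_
      simp
    rw [h1]
    calc B * m₁ = ∑ b ∈ F, (m₁ : ℝ) := by simp [hBdef]
      _ ≤ _ := Finset.sum_le_sum fun b hb => by exact_mod_cast hcard b hb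
  have hsumHi : B * m₁ / 2 ≤ ∑ x ∈ Hi, μ x := by
    have h1 := Finset.sum_filter_add_sum_filter_not Finset.univ (fun x => τ ≤ μ x) μ
    have h2 : ∑ x ∈ Finset.univ.filter (fun x => ¬ τ ≤ μ x), μ x ≤ n * τ := by
      calc _ ≤ ∑ x ∈ Finset.univ.filter (fun x => ¬ τ ≤ μ x), τ :=
            Finset.sum_le_sum fun x hx => (not_le.1 (Finset.mem_filter.1 hx).2).le
        _ ≤ ∑ _x : α, τ :=
            Finset.sum_le_sum_of_subset_of_nonneg (Finset.filter_subset _ _) fun _ _ _ => hτ0.le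
        _ = n * τ := by simp [hndef]
    have h3 : n * τ = B * m₁ / 2 := by rw [hτ]; field_simp
    linarith
  have hswap : ∀ f : ι → ι → α → ℝ,
      ∑ b ∈ F, ∑ b' ∈ F, ∑ x ∈ Hi ∩ (X b ∩ X b'), f b b' x =
        ∑ x ∈ Hi, ∑ b ∈ F.filter (fun b => x ∈ X b), ∑ b' ∈ F.filter (fun b => x ∈ X b),
          f b b' x := by
    intro f
    have e1 : ∀ b b', ∑ x ∈ Hi ∩ (X b ∩ X b'), f b b' x =
        ∑ x ∈ Hi, if x ∈ X b then (if x ∈ X b' then f b b' x else 0) else 0 := by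
      intro b b'
      simp_rw [← ite_and]
      rw [← Finset.sum_filter]
      refine Finset.sum_congr ?_ fun _ _ => rfl
      ext x
      simp
    calc _ = ∑ b ∈ F, ∑ x ∈ Hi, ∑ b' ∈ F,
          (if x ∈ X b then (if x ∈ X b' then f b b' x else 0) else 0) := by
          refine Finset.sum_congr rfl fun b _ => ?_
          rw [Finset.sum_comm]
          exact Finset.sum_congr rfl fun b' _ => e1 b b'
      _ = _ := by
          rw [Finset.sum_comm]
          refine Finset.sum_congr rfl fun x _ => ?_
          rw [Finset.sum_filter]
          refine Finset.sum_congr rfl fun b _ => ?_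
          split_ifs
          · rw [Finset.sum_filter]
          · simp
  -- The gain in `b` of a jump from `x` to `y`, measured against their distance in `b'`. Incidences
  -- `(b, b', x)` have weight `1 / μ x`, which makes the total linear in the multiplicities.
  set Q : ι → ι → α → ℝ := fun b b' x =>
    ∑ y ∈ (X b ∩ X b').erase x, (|(pos b x : ℝ) - pos b y| - 1) / |(pos b' x : ℝ) - pos b' y|
    with hQ
  set T : ℝ := ∑ b ∈ F, ∑ b' ∈ F, ∑ x ∈ Hi ∩ (X b ∩ X b'), Q b b' x / μ x with hT
  have hT' : ∑ b ∈ F, ∑ b' ∈ F, ∑ x ∈ Hi ∩ (X b ∩ X b'), Q b' b x / μ x = T := by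
    rw [hT, Finset.sum_comm]
    refine Finset.sum_congr rfl fun b _ => Finset.sum_congr rfl fun b' _ => ?_
    rw [Finset.inter_comm (X b)]
  have htotal : ∑ b ∈ F, ∑ b' ∈ F, ∑ x ∈ Hi ∩ (X b ∩ X b'), 1 / μ x = ∑ x ∈ Hi, μ x := by
    rw [hswap]
    refine Finset.sum_congr rfl fun x hx => ?_
    have := (hμpos x hx).ne'
    simp only [Finset.sum_const, nsmul_eq_mul]
    change μ x * (μ x * (1 / μ x)) = μ x
    field_simp
  -- Each meeting pair contributes at most `3 / τ`, and without a hub there are at most `B * (m₁² /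
  -- (24n) * B)` such pairs.
  have hsmall : ∑ b ∈ F, ∑ b' ∈ F, ∑ x ∈ Hi ∩ (X b ∩ X b'),
      (if (X b ∩ X b').card ≤ 3 then 1 / μ x else 0) ≤ B * m₁ / 4 := by
    have h1 : ∀ b b', ∑ x ∈ Hi ∩ (X b ∩ X b'),
        (if (X b ∩ X b').card ≤ 3 then 1 / μ x else 0) ≤
          if (X b ∩ X b').Nonempty then 3 / τ else 0 := by
      intro b b'
      by_cases hne : (X b ∩ X b').Nonempty
      · rw [if_pos hne]
        by_cases hc : (X b ∩ X b').card ≤ 3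
        · simp only [hc, if_true]
          calc _ ≤ ∑ x ∈ Hi ∩ (X b ∩ X b'), 1 / τ := by
                refine Finset.sum_le_sum fun x hx => ?_
                exact one_div_le_one_div_of_le hτ0
                  (Finset.mem_filter.1 (Finset.mem_inter.1 hx).1).2
            _ = (Hi ∩ (X b ∩ X b')).card * (1 / τ) := by simp
            _ ≤ 3 * (1 / τ) := by
                refine mul_le_mul_of_nonneg_right ?_ (by positivity)
                exact_mod_cast (Finset.card_le_card Finset.inter_subset_right).trans hc
            _ = 3 / τ := by ring
        · simp only [hc, if_false, Finset.sum_const_zero]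
          positivity
      · rw [Finset.not_nonempty_iff_eq_empty.1 hne]
        simp
    calc _ ≤ ∑ b ∈ F, ∑ b' ∈ F, (if (X b ∩ X b').Nonempty then 3 / τ else 0) :=
          Finset.sum_le_sum fun b _ => Finset.sum_le_sum fun b' _ => h1 b b'
      _ = ∑ b' ∈ F, ((F.filter fun b => (X b ∩ X b').Nonempty).card : ℝ) * (3 / τ) := by
          rw [Finset.sum_comm]
          refine Finset.sum_congr rfl fun b' _ => ?_
          rw [← Finset.sum_filter, Finset.sum_const, nsmul_eq_mul]
      _ ≤ ∑ b' ∈ F, ((m₁ : ℝ) ^ 2 / (24 * n) * B) * (3 / τ) := by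
          refine Finset.sum_le_sum fun b' hb' => ?_
          exact mul_le_mul_of_nonneg_right (hhub b' hb').le (by positivity)
      _ = B * m₁ / 4 := by
          rw [Finset.sum_const, nsmul_eq_mul, hτ]
          change B * _ = _
          field_simp
          norm_num
  have hpt : ∑ x ∈ Hi, μ x ≤ B * m₁ / 4 + 4 * T := by
    have hpw : ∀ b ∈ F, ∀ b' ∈ F, ∀ x ∈ Hi ∩ (X b ∩ X b'), 1 / μ x ≤
        (if (X b ∩ X b').card ≤ 3 then 1 / μ x else 0) +
          (2 * (Q b b' x / μ x) + 2 * (Q b' b x / μ x)) := by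
      intro b hb b' hb' x hx
      have hx' := (Finset.mem_inter.1 hx).2
      have hμx := hμpos x (Finset.mem_inter.1 hx).1
      have hnn : ∀ c ∈ F, ∀ c' ∈ F, x ∈ X c → 0 ≤ Q c c' x := by
        intro c hc c' _ hxc
        refine Finset.sum_nonneg fun y hy => div_nonneg ?_ (abs_nonneg _)
        simp only [Finset.mem_erase, Finset.mem_inter] at hy
        exact sub_nonneg.2 (one_le_abs_sub_of_injOn (hinj c hc) hxc hy.2.1 hy.1)
      split_ifs with hc
      · have h1 := div_nonneg (hnn b hb b' hb' (Finset.mem_inter.1 hx').1) hμx.le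
        have h2 := div_nonneg (hnn b' hb' b hb (Finset.mem_inter.1 hx').2) hμx.le
        linarith
      · have h := half_le_sum_ratio (hinj b hb) (hinj b' hb') (by omega) hx'
        have h' : 1 / 2 ≤ Q b b' x + Q b' b x := by
          rw [hQ]; simp only; rw [Finset.inter_comm (X b') (X b)]; exact h
        have : 1 / μ x ≤ (2 * (Q b b' x + Q b' b x)) / μ x :=
          div_le_div_of_nonneg_right (by linarith) hμx.le
        calc _ ≤ _ := this
          _ = _ := by ring
    rw [← htotal]
    calc _ ≤ ∑ b ∈ F, ∑ b' ∈ F, ∑ x ∈ Hi ∩ (X b ∩ X b'),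
          ((if (X b ∩ X b').card ≤ 3 then 1 / μ x else 0) +
            (2 * (Q b b' x / μ x) + 2 * (Q b' b x / μ x))) :=
          Finset.sum_le_sum fun b hb => Finset.sum_le_sum fun b' hb' =>
            Finset.sum_le_sum fun x hx => hpw b hb b' hb' x hx
      _ = _ + (2 * T + 2 * T) := by
          simp only [Finset.sum_add_distrib, ← Finset.mul_sum]
          rw [hT', ← hT]
      _ ≤ _ := by linarith
  -- For fixed `x` and `b'`, summing over `b` first leaves the total gain of the pair `(x, y)`,
  -- below `g`, times the inverse distance in `b'`. The harmonic bound gives `2 * H * g`, and the `μ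
  -- x` choices of `b'` cancel the weight.
  have hTle : T ≤ B * m₁ / 32 := by
    set g : ℝ := B * m₁ / (64 * n * H) with hg
    have hg0 : 0 < g := by positivity
    have hx : ∀ x ∈ Hi, ∑ b ∈ F.filter (fun b => x ∈ X b), ∑ b' ∈ F.filter (fun b => x ∈ X b),
        Q b b' x / μ x ≤ 2 * H * g := by
      intro x hx
      have hμx := hμpos x hx
      rw [Finset.sum_comm]
      have hb : ∀ b' ∈ F.filter (fun b => x ∈ X b),
          ∑ b ∈ F.filter (fun b => x ∈ X b), Q b b' x / μ x ≤ 2 * H * g / μ x := by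
        intro b' hb'
        obtain ⟨hb'F, hxb'⟩ := Finset.mem_filter.1 hb'
        rw [← Finset.sum_div]
        refine div_le_div_of_nonneg_right ?_ hμx.le
        rw [hQ]
        simp only
        rw [Finset.sum_comm' (s' := fun y => F.filter fun b => x ∈ X b ∧ y ∈ X b)
          (t' := (X b').erase x)]
        · calc _ ≤ ∑ y ∈ (X b').erase x, g * (1 / |(pos b' x : ℝ) - pos b' y|) := by
                refine Finset.sum_le_sum fun y hy => ?_
                rw [← Finset.sum_div, div_eq_mul_one_div]
                refine mul_le_mul_of_nonneg_right ?_ (by positivity)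
                exact (hgain x y (Finset.mem_erase.1 hy).1.symm).le
            _ ≤ g * (2 * H) := by
                rw [← Finset.mul_sum]
                exact mul_le_mul_of_nonneg_left
                  (sum_one_div_dist_le (hinj b' hb'F) (hpos b' hb'F) hxb') hg0.le
            _ = _ := by ring
        · intro b y
          simp only [Finset.mem_filter, Finset.mem_erase, Finset.mem_inter]
          tauto
      calc _ ≤ ∑ b' ∈ F.filter (fun b => x ∈ X b), 2 * H * g / μ x := Finset.sum_le_sum hb
        _ = μ x * (2 * H * g / μ x) := by rw [Finset.sum_const, nsmul_eq_mul]
        _ = _ := by field_simp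
    calc T ≤ ∑ x ∈ Hi, 2 * H * g := by rw [hT, hswap]; exact Finset.sum_le_sum hx
      _ = Hi.card * (2 * H * g) := by simp
      _ ≤ n * (2 * H * g) := mul_le_mul_of_nonneg_right hHicard (by positivity)
      _ = _ := by rw [hg]; field_simp; norm_num
  -- The estimates combine to `B * m₁ / 2 ≤ B * m₁ / 4 + B * m₁ / 8`.
  have : 0 < B * m₁ := by positivity
  linarith

end Overlap

/-! ### Greedy rounds and hitting sets. -/

section Greedy

/-- The number of rounds after which a quantity that starts at `B` and loses a fraction `θ` in each
round drops below one. -/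
noncomputable def greedyBound (θ : ℝ) (B : ℕ) : ℝ :=
  if B = 0 then 0 else (1 + Real.log B) / θ

theorem greedyBound_le {θ : ℝ} (hθ : 0 < θ) (B : ℕ) :
    greedyBound θ B ≤ (1 + Real.log B) / θ := by
  unfold greedyBound
  split_ifs with h
  · have := Real.log_natCast_nonneg B
    positivity
  · exact le_rfl

theorem greedyBound_nonneg {θ : ℝ} (hθ : 0 < θ) (B : ℕ) : 0 ≤ greedyBound θ B := by
  unfold greedyBound
  have := Real.log_natCast_nonneg B
  split_ifs <;> positivity

theorem greedyBound_mono {θ : ℝ} (hθ : 0 < θ) {B B' : ℕ} (h : B' ≤ B) :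
    greedyBound θ B' ≤ greedyBound θ B := by
  by_cases h0 : B' = 0
  · rw [greedyBound, if_pos h0]
    exact greedyBound_nonneg hθ B
  · rw [greedyBound, greedyBound, if_neg h0, if_neg (by omega)]
    have : Real.log B' ≤ Real.log B := Real.log_le_log (by positivity) (by exact_mod_cast h)
    gcongr

/-- Since `log (1 - θ) ≤ -θ`, a round lowers `(log B) / θ` by at least one. The extra `1 / θ` pays
for the round that reaches zero. -/
theorem greedyBound_add_one_le {θ : ℝ} (hθ : 0 < θ) (hθ1 : θ ≤ 1) {B B' : ℕ} (hB : 0 < B)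
    (h : (B' : ℝ) ≤ (1 - θ) * B) : greedyBound θ B' + 1 ≤ greedyBound θ B := by
  have hB1 : (0 : ℝ) < B := by exact_mod_cast hB
  rw [greedyBound, greedyBound, if_neg (by omega : B ≠ 0)]
  have hlog := Real.log_natCast_nonneg B
  split_ifs with h0
  · rw [zero_add, le_div_iff₀ hθ]
    linarith
  · have hB' : (0 : ℝ) < B' := by positivity
    have h1 : 0 < 1 - θ := by
      by_contra hc
      have : (1 - θ) * B ≤ 0 := mul_nonpos_of_nonpos_of_nonneg (not_lt.1 hc) hB1.le
      linarith
    have h2 : Real.log B' ≤ Real.log (1 - θ) + Real.log B := by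
      rw [← Real.log_mul h1.ne' hB1.ne']
      exact Real.log_le_log hB' h
    have h3 := Real.log_le_sub_one_of_pos h1
    rw [div_add_one hθ.ne']
    exact div_le_div_of_nonneg_right (by linarith) hθ.le

/-- By averaging, some point lies in at least a fraction `b / n` of the remaining sets; it is taken
greedily. -/
theorem exists_hittingSet {α : Type*} [Fintype α] [DecidableEq α] {b : ℕ} (hb : 0 < b)
    (F : Finset (Finset α)) (hF : ∀ X ∈ F, b ≤ X.card) :
    ∃ S : Finset α, (∀ X ∈ F, ∃ x ∈ X, x ∈ S) ∧
      (S.card : ℝ) ≤ greedyBound (b / Fintype.card α) F.card := by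
  induction hN : F.card using Nat.strong_induction_on generalizing F with
  | _ N ih =>
    rcases F.eq_empty_or_nonempty with rfl | ⟨X₀, hX₀⟩
    · exact ⟨∅, by simp, by simp [← hN, greedyBound]⟩
    have hn : 0 < Fintype.card α := by
      obtain ⟨x, -⟩ := Finset.card_pos.1 (hb.trans_le (hF _ hX₀))
      exact Fintype.card_pos_iff.2 ⟨x⟩
    have hn' : (0 : ℝ) < Fintype.card α := by exact_mod_cast hn
    have hbn : b ≤ Fintype.card α := (hF _ hX₀).trans (Finset.card_le_univ _)
    have hθ : (0 : ℝ) < b / Fintype.card α := by positivity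
    have hθ1 : (b : ℝ) / Fintype.card α ≤ 1 := by
      rw [div_le_one hn']; exact_mod_cast hbn
    have hN0 : 0 < N := hN ▸ Finset.card_pos.2 ⟨X₀, hX₀⟩
    obtain ⟨x, hx⟩ : ∃ x : α, (b : ℝ) / Fintype.card α * N ≤ (F.filter fun X => x ∈ X).card := by
      by_contra! hcon
      have h1 : ∑ x : α, ((F.filter fun X => x ∈ X).card : ℝ) = ∑ X ∈ F, (X.card : ℝ) := by
        have : ∀ x : α, ((F.filter fun X => x ∈ X).card : ℝ) =
            ∑ X ∈ F, if x ∈ X then (1 : ℝ) else 0 := by intro x; simp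
        simp_rw [this]
        rw [Finset.sum_comm]
        refine Finset.sum_congr rfl fun b _ => ?_
        simp
      have h2 : (N : ℝ) * b ≤ ∑ X ∈ F, (X.card : ℝ) := by
        calc (N : ℝ) * b = ∑ X ∈ F, (b : ℝ) := by simp [hN]
          _ ≤ _ := Finset.sum_le_sum fun X hX => by exact_mod_cast hF X hX
      have : Nonempty α := Fintype.card_pos_iff.1 hn
      have h3 : ∑ x : α, ((F.filter fun X => x ∈ X).card : ℝ) <
          ∑ _x : α, (b : ℝ) / Fintype.card α * N :=
        Finset.sum_lt_sum_of_nonempty Finset.univ_nonempty fun x _ => hcon x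
      have h4 : ∑ _x : α, (b : ℝ) / Fintype.card α * N = N * b := by
        simp only [Finset.sum_const, Finset.card_univ, nsmul_eq_mul]
        field_simp
      linarith
    have hsplit := Finset.card_filter_add_card_filter_not (s := F) (fun X => x ∈ X)
    have hdec : ((F.filter fun X => x ∉ X).card : ℝ) ≤ (1 - (b : ℝ) / Fintype.card α) * N := by
      have : ((F.filter fun X => x ∈ X).card : ℝ) + (F.filter fun X => x ∉ X).card = N := by
        rw [← hN]; exact_mod_cast hsplit
      linarith
    have hlt : (F.filter fun X => x ∉ X).card < N := by
      have h1 : (0 : ℝ) < N := by exact_mod_cast hN0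
      have h2 := mul_pos hθ h1
      have : ((F.filter fun X => x ∉ X).card : ℝ) < N := by linarith
      exact_mod_cast this
    obtain ⟨S, hS, hcard⟩ := ih _ hlt (F.filter fun X => x ∉ X)
      (fun X hX => hF X (Finset.mem_filter.1 hX).1) rfl
    refine ⟨insert x S, fun X hX => ?_, ?_⟩
    · by_cases hxX : x ∈ X
      · exact ⟨x, hxX, Finset.mem_insert_self _ _⟩
      · obtain ⟨y, hy, hyS⟩ := hS X (Finset.mem_filter.2 ⟨hX, hxX⟩)
        exact ⟨y, hy, Finset.mem_insert_of_mem hyS⟩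
    · have h1 := greedyBound_add_one_le hθ hθ1 hN0 hdec
      have h2 : ((insert x S).card : ℝ) ≤ S.card + 1 := by
        exact_mod_cast Finset.card_insert_le _ _
      linarith

end Greedy

/-! ### One level: storing hubs and adding profitable links. -/

section Level

variable {α : Type*} {d : α → α → ℝ≥0∞}

/-- The least number of links of a geodesic chain. -/
noncomputable def minHops (d : α → α → ℝ≥0∞) (A : Set (α × α)) (x y : α) : ℕ :=
  sInf {k | Geo d A k x y}

theorem minHops_le {A : Set (α × α)} {k : ℕ} {x y : α} (h : Geo d A k x y) :
    minHops d A x y ≤ k := Nat.sInf_le h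

theorem GeoLE.minHops_spec {A : Set (α × α)} {k : ℕ} {x y : α} (h : GeoLE d A k x y) :
    Geo d A (minHops d A x y) x y :=
  Nat.sInf_mem (s := {k | Geo d A k x y}) ⟨h.choose, h.choose_spec.2⟩

theorem GeoLE.minHops_le {A : Set (α × α)} {k : ℕ} {x y : α} (h : GeoLE d A k x y) :
    minHops d A x y ≤ k := by
  obtain ⟨j, hj, h⟩ := h
  exact (_root_.minHops_le h).trans hj

theorem IsShortestVia.le_minHops {A : Set (α × α)} {m k : ℕ} {u v : α} {X : Finset α}
    {pos : α → ℕ} (hX : IsShortestVia d A u v k X pos) (h : GeoLE d A m u v) :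
    k ≤ minHops d A u v := by
  by_contra hc
  exact hX.minimal _ (not_le.1 hc) h.minHops_spec

/-- Adding a link between two points of a shortest geodesic chain shortens the chain. -/
theorem IsShortestVia.minHops_insert_le (hd : IsQuasiMetric d) {A A' : Set (α × α)} {m k : ℕ}
    {u v : α} {X : Finset α} {pos : α → ℕ} (hX : IsShortestVia d A u v k X pos)
    (h : GeoLE d A m u v) (hA : A ⊆ A') {x y : α} (hx : x ∈ X) (hy : y ∈ X) (hxy : (x, y) ∈ A')
    (hyx : (y, x) ∈ A') :
    (minHops d A' u v : ℝ) ≤ minHops d A u v - (|(pos x : ℝ) - pos y| - 1) := by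
  wlog hle : pos x ≤ pos y generalizing x y
  · rw [abs_sub_comm]
    exact this hy hx hyx hxy (not_le.1 hle).le
  have h1 := ((hX.geo_left x hx).mono hA).append hd
    (Geo.single hd hxy ((hX.geo x hx y hy hle).ne_top hd)) (hX.between x hx y hy hle)
  have h2 := h1.append hd ((hX.geo_right y hy).mono hA) (hX.between_ends y hy)
  have h3 : minHops d A' u v + pos y ≤ pos x + 1 + k := by
    have := minHops_le h2
    have := hX.pos_le y hy
    omega
  have h4 := hX.le_minHops h
  have h5 : (minHops d A' u v : ℝ) + pos y ≤ pos x + 1 + minHops d A u v := by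
    exact_mod_cast h3.trans (by omega)
  have h6 : (pos x : ℝ) ≤ pos y := by exact_mod_cast hle
  rw [abs_sub_comm, abs_of_nonneg (by linarith)]
  linarith

/-- A few chains and a few extra links suffice to reduce the number of links of all target pairs
that the chains do not meet by a factor of four. -/
theorem exists_chains_and_links_of_minHops [Fintype α] [DecidableEq α] (hd : IsQuasiMetric d)
    {L : ℝ} (hL : 0 ≤ L) {m : ℕ} (hm : 0 < m) (A : Set (α × α)) (T : Finset (α × α))
    (hT : ∀ e ∈ T, GeoLE d A (4 * m) e.1 e.2 ∧ d e.1 e.2 ≤ ENNReal.ofReal L) :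
    ∃ (N : Finset (α × α)) (P : Finset (Finset α)),
      (∀ Y ∈ P, IsGeodesicChain d L Y ∧ Y.card ≤ 4 * m + 1) ∧
      (∀ e ∈ T, GeoLE d (A ∪ N) m e.1 e.2 ∨
        ∃ Y ∈ P, ∃ z ∈ Y, d e.1 z + d z e.2 = d e.1 e.2 ∧ GeoLE d (A ∪ N) (4 * m) z e.2) ∧
      (P.card : ℝ) ≤ greedyBound ((m : ℝ) ^ 2 / (24 * Fintype.card α)) T.card ∧
      (N.card : ℝ) ≤ 2 * greedyBound
        (1 / (256 * Fintype.card α * (1 + Real.log (4 * m : ℕ))))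
        (∑ e ∈ T, minHops d A e.1 e.2) := by
  classical
  induction hΦ : ∑ e ∈ T, minHops d A e.1 e.2 using Nat.strong_induction_on
    generalizing A T with
  | _ Φ ih =>
    -- Only the bad pairs enter the dichotomy. A hub shrinks their number by the factor `1 - θ`, a
    -- spread pair shrinks their total link count by `1 - θ'`. Either way the potential drops.
    set Bad := T.filter fun e => ¬ GeoLE d A m e.1 e.2 with hBad
    have hBadT : Bad ⊆ T := Finset.filter_subset _ _
    rcases Bad.eq_empty_or_nonempty with hE | hne
    · refine ⟨∅, ∅, by simp, fun e he => Or.inl ?_, ?_, ?_⟩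
      · have : e ∉ Bad := by rw [hE]; simp
        rw [hBad, Finset.mem_filter, not_and, not_not] at this
        exact (this he).mono Set.subset_union_left le_rfl
      · simp only [Finset.card_empty, Nat.cast_zero]
        rw [greedyBound]
        have := Real.log_natCast_nonneg T.card
        split_ifs <;> positivity
      · simp only [Finset.card_empty, Nat.cast_zero]
        rw [greedyBound]
        have := Real.log_natCast_nonneg Φ
        have := Real.log_natCast_nonneg (4 * m)
        split_ifs <;> positivity
    have hsh : ∀ e : α × α, ∃ k X pos, e ∈ Bad →
        k ≤ 4 * m ∧ IsShortestVia d A e.1 e.2 k X pos := by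
      intro e
      by_cases he : e ∈ Bad
      · obtain ⟨k, hk, X, pos, h⟩ := (hT e (hBadT he)).1.exists_shortest hd
        exact ⟨k, X, pos, fun _ => ⟨hk, h⟩⟩
      · exact ⟨0, ∅, fun _ => 0, fun h => absurd h he⟩
    choose k X pos hX using hsh
    have hkm : ∀ e ∈ Bad, m < k e := by
      intro e he
      by_contra hc
      obtain ⟨x, hx, hx0⟩ := (hX e he).2.exists_pos (k e) le_rfl
      have h1 := ((hX e he).2.geo_left x hx).append hd ((hX e he).2.geo_right x hx)
        ((hX e he).2.between_ends x hx)
      refine (Finset.mem_filter.1 he).2 ⟨_, ?_, h1⟩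
      omega
    have hminpos : ∀ e ∈ Bad, 0 < minHops d A e.1 e.2 := fun e he =>
      lt_of_lt_of_le (by have := hkm e he; omega)
        ((hX e he).2.le_minHops (hT e (hBadT he)).1)
    obtain ⟨e₀, he₀⟩ := hne
    have hn : 0 < Fintype.card α := Fintype.card_pos_iff.2 ⟨e₀.1⟩
    have hn' : (0 : ℝ) < Fintype.card α := by exact_mod_cast hn
    have hn1 : (1 : ℝ) ≤ Fintype.card α := by exact_mod_cast hn
    have hm' : (0 : ℝ) < m := by exact_mod_cast hm
    have hH : 1 ≤ 1 + Real.log (4 * m : ℕ) := by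
      have := Real.log_natCast_nonneg (4 * m)
      linarith
    set H := 1 + Real.log (4 * m : ℕ) with hHdef
    have hH0 : 0 < H := by linarith
    set θ : ℝ := (m : ℝ) ^ 2 / (24 * Fintype.card α) with hθdef
    set θ' : ℝ := 1 / (256 * Fintype.card α * H) with hθ'def
    have hθ0 : 0 < θ := by positivity
    have hθ'0 : 0 < θ' := by positivity
    have hBpos : 0 < Bad.card := Finset.card_pos.2 ⟨e₀, he₀⟩
    have hBpos' : (0 : ℝ) < Bad.card := by exact_mod_cast hBpos
    have hshort : ∀ e ∈ T, e ∉ Bad → ∀ N : Set (α × α), GeoLE d (A ∪ N) m e.1 e.2 := by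
      intro e he heB N
      have : GeoLE d A m e.1 e.2 := by
        by_contra hc
        exact heB (Finset.mem_filter.2 ⟨he, hc⟩)
      exact this.mono Set.subset_union_left le_rfl
    have hΦT : ∑ e ∈ Bad, minHops d A e.1 e.2 ≤ Φ := by
      rw [← hΦ]; exact Finset.sum_le_sum_of_subset hBadT
    rcases exists_hub_or_exists_spread_pair Bad ⟨e₀, he₀⟩ X pos (m₁ := m) (m₂ := 4 * m) hm
      (fun e he => by rw [(hX e he).2.card]; have := hkm e he; omega)
      (fun e he => (hX e he).2.pos_inj)
      (fun e he x hx => ((hX e he).2.pos_le x hx).trans (hX e he).1) with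
      ⟨b', hb', hhub⟩ | ⟨x, y, hxy, hgain⟩
    · set T' := Bad.filter fun b => ¬ (X b ∩ X b').Nonempty with hT'
      have hsplit := Finset.card_filter_add_card_filter_not (s := Bad)
        (fun b => (X b ∩ X b').Nonempty)
      have hsplit' : ((Bad.filter fun b => (X b ∩ X b').Nonempty).card : ℝ) + T'.card =
          Bad.card := by exact_mod_cast hsplit
      have hθ1 : θ ≤ 1 := by
        have h1 : θ * Bad.card ≤ Bad.card := hhub.trans (by exact_mod_cast Finset.card_filter_le _ _)
        by_contra hc
        have := mul_lt_mul_of_pos_right (not_le.1 hc) hBpos'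
        linarith
      have hT'sub : T' ⊆ Bad := Finset.filter_subset _ _
      have hdec : (T'.card : ℝ) ≤ (1 - θ) * Bad.card := by linarith
      have hb'T' : b' ∉ T' := by
        intro h
        refine (Finset.mem_filter.1 h).2 ?_
        rw [Finset.inter_self]
        exact Finset.card_pos.1 (by rw [(hX b' hb').2.card]; omega)
      have hΦ' : ∑ e ∈ T', minHops d A e.1 e.2 < Φ := by
        refine lt_of_lt_of_le ?_ hΦT
        exact Finset.sum_lt_sum_of_subset hT'sub hb' hb'T' (hminpos b' hb') fun _ _ _ => Nat.zero_le _
      obtain ⟨N, P, hP, hcov, hPc, hNc⟩ := ih _ hΦ' A T' (fun e he => hT e (hBadT (hT'sub he))) rfl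
      refine ⟨N, insert (X b') P, ?_, ?_, ?_, ?_⟩
      · intro Y hY
        rcases Finset.mem_insert.1 hY with rfl | hY
        · refine ⟨(hX b' hb').2.isGeodesicChain hd hL (hT b' (hBadT hb')).2, ?_⟩
          rw [(hX b' hb').2.card]
          have := (hX b' hb').1
          omega
        · exact hP Y hY
      · intro e he
        by_cases heB : e ∈ Bad
        · by_cases heT : e ∈ T'
          · rcases hcov e heT with h | ⟨Y, hY, h⟩
            · exact Or.inl h
            · exact Or.inr ⟨Y, Finset.mem_insert_of_mem hY, h⟩
          · have hmeet : (X e ∩ X b').Nonempty := by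
              by_contra hc
              exact heT (Finset.mem_filter.2 ⟨heB, hc⟩)
            obtain ⟨z, hz⟩ := hmeet
            obtain ⟨hz1, hz2⟩ := Finset.mem_inter.1 hz
            refine Or.inr ⟨X b', Finset.mem_insert_self _ _, z, hz2,
              (hX e heB).2.between_ends z hz1, _, ?_,
              ((hX e heB).2.geo_right z hz1).mono Set.subset_union_left⟩
            have := (hX e heB).1
            omega
        · exact Or.inl (hshort e he heB _)
      · have h1 := greedyBound_add_one_le hθ0 hθ1 hBpos hdec
        have h2 := greedyBound_mono hθ0 (Finset.card_le_card hBadT)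
        have h3 : ((insert (X b') P).card : ℝ) ≤ P.card + 1 := by
          exact_mod_cast Finset.card_insert_le _ _
        linarith
      · have := greedyBound_mono hθ'0 hΦ'.le
        linarith
    -- Different chains may visit `x` and `y` in different orders, so both directions are added;
    -- this is the factor `2` in the bound for `N`.
    · set A' : Set (α × α) := A ∪ ({(x, y), (y, x)} : Finset (α × α)) with hA'
      have hAA' : A ⊆ A' := Set.subset_union_left
      have hmono : ∀ e ∈ Bad, minHops d A' e.1 e.2 ≤ minHops d A e.1 e.2 := fun e he =>
        minHops_le ((hT e (hBadT he)).1.minHops_spec.mono hAA')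
      have hΦ'r : ((∑ e ∈ Bad, minHops d A' e.1 e.2 : ℕ) : ℝ) ≤
          (∑ e ∈ Bad, minHops d A e.1 e.2 : ℕ) - Bad.card * m / (64 * Fintype.card α * H) := by
        push_cast
        have h1 : ∑ e ∈ Bad, (minHops d A' e.1 e.2 : ℝ) ≤ ∑ e ∈ Bad,
            ((minHops d A e.1 e.2 : ℝ) -
              if x ∈ X e ∧ y ∈ X e then |(pos e x : ℝ) - pos e y| - 1 else 0) := by
          refine Finset.sum_le_sum fun e he => ?_
          split_ifs with h
          · exact (hX e he).2.minHops_insert_le hd (hT e (hBadT he)).1 hAA' h.1 h.2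
              (by simp [hA']) (by simp [hA'])
          · rw [sub_zero]
            exact_mod_cast hmono e he
        rw [Finset.sum_sub_distrib, ← Finset.sum_filter] at h1
        linarith
      have hΦB : ((∑ e ∈ Bad, minHops d A e.1 e.2 : ℕ) : ℝ) ≤ Bad.card * (4 * m) := by
        push_cast
        calc _ ≤ ∑ e ∈ Bad, (4 * m : ℝ) := Finset.sum_le_sum fun e he => by
              exact_mod_cast (hT e (hBadT he)).1.minHops_le
          _ = _ := by simp
      -- A bad pair has at most `4 * m` links, so the absolute gain is at least a fraction `θ'` of
      -- the potential.
      have hgain' : θ' * (∑ e ∈ Bad, minHops d A e.1 e.2 : ℕ) ≤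
          Bad.card * m / (64 * Fintype.card α * H) := by
        calc _ ≤ θ' * (Bad.card * (4 * m)) := mul_le_mul_of_nonneg_left hΦB hθ'0.le
          _ = _ := by rw [hθ'def]; field_simp; norm_num
      have hΦBpos : 0 < ∑ e ∈ Bad, minHops d A e.1 e.2 :=
        Finset.sum_pos hminpos ⟨e₀, he₀⟩
      have hθ'1 : θ' ≤ 1 := by
        rw [hθ'def, div_le_one (by positivity)]
        have : 1 ≤ (Fintype.card α : ℝ) * H := one_le_mul_of_one_le_of_one_le hn1 hH
        linarith
      have hdec : ((∑ e ∈ Bad, minHops d A' e.1 e.2 : ℕ) : ℝ) ≤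
          (1 - θ') * (∑ e ∈ Bad, minHops d A e.1 e.2 : ℕ) := by linarith
      have hΦ' : ∑ e ∈ Bad, minHops d A' e.1 e.2 < Φ := by
        refine lt_of_lt_of_le ?_ hΦT
        have : (0 : ℝ) < (∑ e ∈ Bad, minHops d A e.1 e.2 : ℕ) := by exact_mod_cast hΦBpos
        have := mul_pos hθ'0 this
        have h2 : ((∑ e ∈ Bad, minHops d A' e.1 e.2 : ℕ) : ℝ) <
          (∑ e ∈ Bad, minHops d A e.1 e.2 : ℕ) := by linarith
        exact_mod_cast h2
      obtain ⟨N, P, hP, hcov, hPc, hNc⟩ := ih _ hΦ' A' Bad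
        (fun e he => ⟨(hT e (hBadT he)).1.mono hAA' le_rfl, (hT e (hBadT he)).2⟩) rfl
      have hAN : A' ∪ N = A ∪ ({(x, y), (y, x)} ∪ N : Finset (α × α)) := by
        rw [hA', Set.union_assoc, Finset.coe_union]
      refine ⟨{(x, y), (y, x)} ∪ N, P, hP, ?_, ?_, ?_⟩
      · intro e he
        by_cases heB : e ∈ Bad
        · rw [← hAN]; exact hcov e heB
        · exact Or.inl (hshort e he heB _)
      · exact hPc.trans (greedyBound_mono hθ0 (Finset.card_le_card hBadT))
      · have h1 := greedyBound_add_one_le hθ'0 hθ'1 hΦBpos hdec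
        have h2 := greedyBound_mono hθ'0 hΦT
        have h3 : ((({(x, y), (y, x)} ∪ N : Finset (α × α))).card : ℝ) ≤ 2 + N.card := by
          have := Finset.card_union_le ({(x, y), (y, x)} : Finset (α × α)) N
          have h4 : ({(x, y), (y, x)} : Finset (α × α)).card ≤ 2 := Finset.card_le_two
          exact_mod_cast this.trans (by omega)
        linarith

end Level

/-! ### Halving the number of links repeatedly. -/

section Route

variable {α : Type*} {d : α → α → ℝ≥0∞}

theorem GeoLE.exists_split (hd : IsQuasiMetric d) {A : Set (α × α)} {a b : ℕ} {u v : α}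
    (h : GeoLE d A (a + b) u v) :
    ∃ p, GeoLE d A a u p ∧ GeoLE d A b p v ∧ d u p + d p v = d u v := by
  obtain ⟨k, hk, h⟩ := h
  obtain ⟨p, h0, hpk, hgeo, hsum⟩ := h.exists_seq hd
  have h1 := hgeo 0 (min a k) (Nat.zero_le _) (min_le_right _ _)
  have h2 := hgeo (min a k) k (min_le_right _ _) le_rfl
  have h3 := hsum 0 (min a k) k (Nat.zero_le _) (min_le_right _ _) le_rfl
  rw [h0] at h1 h3
  rw [hpk] at h2 h3
  exact ⟨p (min a k), ⟨_, by omega, h1⟩, ⟨_, by omega, h2⟩, h3⟩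

/-- `z` lies on a geodesic from `u` to `v` and on one of the sets in `P`. -/
def IsHit (d : α → α → ℝ≥0∞) (P : Finset (Finset α)) (u v z : α) : Prop :=
  d u z + d z v = d u v ∧ ∃ Y ∈ P, z ∈ Y

/-- The hit is taken in the last segment that was not shortened: at most `M` links finish that
segment, and all later segments are short. -/
theorem exists_hit_of_segments (hd : IsQuasiMetric d) {A A' : Set (α × α)}
    {P : Finset (Finset α)} {L : ℝ≥0∞} {M m : ℕ}
    (hseg : ∀ x y, d x y ≤ L → GeoLE d A M x y →
      GeoLE d A' m x y ∨ ∃ z, IsHit d P x y z ∧ GeoLE d A' M z y) (r : ℕ) {u v : α}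
    (hL : d u v ≤ L) (h : GeoLE d A (r * M) u v) :
    GeoLE d A' (r * m) u v ∨ ∃ z, IsHit d P u v z ∧ GeoLE d A' (M + (r - 1) * m) z v := by
  induction r generalizing u with
  | zero =>
    obtain ⟨j, hj, h⟩ := h
    obtain rfl : j = 0 := by omega
    cases h
    exact Or.inl ⟨0, by omega, .nil _⟩
  | succ r ih =>
    rw [Nat.succ_mul, Nat.add_comm] at h
    obtain ⟨p, h1, h2, h3⟩ := h.exists_split hd
    have hup : d u p ≤ L := le_trans (by rw [← h3]; exact le_self_add) hL
    have hpv : d p v ≤ L := le_trans (by rw [← h3]; exact le_add_self) hL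
    rcases ih hpv h2 with h4 | ⟨z, ⟨hz, hzP⟩, hzv⟩
    · rcases hseg u p hup h1 with h5 | ⟨z, ⟨hz, hzP⟩, hzp⟩
      · left
        rw [Nat.succ_mul, Nat.add_comm]
        exact h5.append hd h4 h3
      · right
        have hfin : d u z ≠ ⊤ := by
          have : d u p ≠ ⊤ := by obtain ⟨_, _, h⟩ := h1; exact h.ne_top hd
          exact ne_top_of_le_ne_top this (by rw [← hz]; exact le_self_add)
        have h6 := hd.between_right hfin hz h3
        refine ⟨z, ⟨?_, hzP⟩, ?_⟩
        · rw [← h6, ← add_assoc, hz, h3]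
        · rw [Nat.add_sub_cancel]
          exact hzp.append hd h4 h6
    · right
      refine ⟨z, ⟨?_, hzP⟩, hzv.mono subset_rfl ?_⟩
      · exact hd.between_left h3 hz
      · have : (r - 1) * m ≤ (r + 1 - 1) * m := Nat.mul_le_mul_right _ (by omega)
        omega

/-- The `Õ(n/m²)` stored chains have at most `5 * m` points each, so linking all pairs inside them
costs `Õ(n)`, whatever `m` is. -/
theorem exists_level [Fintype α] [DecidableEq α] (hd : IsQuasiMetric d) {L : ℝ} (hL : 0 ≤ L)
    {m : ℕ} (hm : 0 < m) (hmn : 4 * m ≤ Fintype.card α) (A : Set (α × α)) :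
    ∃ (N : Finset (α × α)) (P : Finset (Finset α)),
      (∀ Y ∈ P, IsGeodesicChain d L Y) ∧
      (∀ u v, d u v ≤ ENNReal.ofReal L → GeoLE d A (16 * m) u v → GeoLE d (A ∪ N) (8 * m) u v ∨
        ∃ z, IsHit d P u v z ∧ GeoLE d (A ∪ N) (8 * m) z v) ∧
      (P.card : ℝ) ≤ 48 * Fintype.card α * (1 + Real.log (Fintype.card α)) / (m : ℝ) ^ 2 ∧
      ((∑ Y ∈ P, Y.card ^ 2 : ℕ) : ℝ) ≤
        1200 * Fintype.card α * (1 + Real.log (Fintype.card α)) ∧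
      (N.card : ℝ) ≤ 1536 * Fintype.card α * (1 + Real.log (Fintype.card α)) ^ 2 := by
  classical
  set T : Finset (α × α) := Finset.univ.filter fun e =>
    GeoLE d A (4 * m) e.1 e.2 ∧ d e.1 e.2 ≤ ENNReal.ofReal L with hT
  obtain ⟨N, P, hP, hcov, hPc, hNc⟩ := exists_chains_and_links_of_minHops hd hL hm A T
    (fun e he => (Finset.mem_filter.1 he).2)
  have hn : 0 < Fintype.card α := by omega
  set n := Fintype.card α with hndef
  have hn' : (0 : ℝ) < n := by exact_mod_cast hn
  have hm' : (0 : ℝ) < m := by exact_mod_cast hm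
  have hlog := Real.log_natCast_nonneg n
  set Λ := 1 + Real.log n with hΛ
  have hTn : T.card ≤ n ^ 2 := by
    refine (Finset.card_le_univ T).trans ?_
    rw [Fintype.card_prod, sq]
  have hPc' : (P.card : ℝ) ≤ 48 * n * Λ / (m : ℝ) ^ 2 := by
    have hθ : (0 : ℝ) < (m : ℝ) ^ 2 / (24 * n) := by positivity
    refine hPc.trans ((greedyBound_mono hθ hTn).trans ((greedyBound_le hθ _).trans ?_))
    push_cast
    rw [Real.log_pow]
    push_cast
    rw [div_div_eq_mul_div]
    refine div_le_div_of_nonneg_right ?_ (by positivity)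
    rw [hΛ]
    nlinarith
  refine ⟨N, P, fun Y hY => (hP Y hY).1, ?_, hPc', ?_, ?_⟩
  · intro u v huv h
    have hseg : ∀ x y, d x y ≤ ENNReal.ofReal L → GeoLE d A (4 * m) x y →
        GeoLE d (A ∪ N) m x y ∨ ∃ z, IsHit d P x y z ∧ GeoLE d (A ∪ N) (4 * m) z y := by
      intro x y hxy h
      rcases hcov (x, y) (Finset.mem_filter.2 ⟨Finset.mem_univ _, h, hxy⟩) with
        h1 | ⟨Y, hY, z, hz, h1, h2⟩
      · exact Or.inl h1
      · exact Or.inr ⟨z, ⟨h1, Y, hY, hz⟩, h2⟩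
    -- Four segments of `4 * m` links become `4 * m` links, or `4 * m + 3 * m` after the hit. Both
    -- are below `8 * m`.
    rcases exists_hit_of_segments hd hseg 4 huv (h.mono subset_rfl (by omega)) with
      h1 | ⟨z, hz, h1⟩
    · exact Or.inl (h1.mono subset_rfl (by omega))
    · exact Or.inr ⟨z, hz, h1.mono subset_rfl (by omega)⟩
  · have h1 : ∑ Y ∈ P, Y.card ^ 2 ≤ P.card * (5 * m) ^ 2 := by
      rw [← smul_eq_mul, ← Finset.sum_const]
      exact Finset.sum_le_sum fun Y hY =>
        Nat.pow_le_pow_left ((hP Y hY).2.trans (by omega)) 2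
    calc ((∑ Y ∈ P, Y.card ^ 2 : ℕ) : ℝ) ≤ P.card * (5 * m) ^ 2 := by exact_mod_cast h1
      _ ≤ 48 * n * Λ / (m : ℝ) ^ 2 * (5 * m) ^ 2 := by gcongr
      _ = 1200 * n * Λ := by field_simp; ring
  · have hlog4 := Real.log_natCast_nonneg (4 * m)
    have hlogle : Real.log (4 * m : ℕ) ≤ Real.log n :=
      Real.log_le_log (by positivity) (by exact_mod_cast hmn)
    have hθ : (0 : ℝ) < 1 / (256 * n * (1 + Real.log (4 * m : ℕ))) := by positivity
    have hΦ : ∑ e ∈ T, minHops d A e.1 e.2 ≤ n ^ 3 := by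
      calc _ ≤ ∑ e ∈ T, n := Finset.sum_le_sum fun e he =>
            (Finset.mem_filter.1 he).2.1.minHops_le.trans hmn
        _ = T.card * n := by rw [Finset.sum_const, smul_eq_mul]
        _ ≤ n ^ 2 * n := Nat.mul_le_mul_right _ hTn
        _ = _ := by ring
    have h1 := (greedyBound_mono hθ hΦ).trans (greedyBound_le hθ _)
    push_cast at h1 hNc
    rw [Real.log_pow, div_div_eq_mul_div, div_one] at h1
    push_cast at h1 hlog4 hlogle
    have h2 : (1 + 3 * Real.log n) * (256 * n * (1 + Real.log (4 * m))) ≤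
        (3 * Λ) * (256 * n * Λ) := by
      rw [hΛ]
      gcongr ?_ * (256 * n * (1 + ?_))
      linarith
    calc (N.card : ℝ) ≤ _ := hNc
      _ ≤ 2 * ((3 * Λ) * (256 * n * Λ)) := by linarith
      _ = _ := by ring

/-- A geodesic route of at most `j` stages, each leading to a point on one of the sets in `P`,
followed by a chain of at most `K` links. -/
def Route (d : α → α → ℝ≥0∞) (A : Set (α × α)) (P : Finset (Finset α)) (K : ℕ) :
    ℕ → α → α → Prop
  | 0, u, v => GeoLE d A K u v
  | j + 1, u, v => Route d A P K j u v ∨ ∃ z, IsHit d P u v z ∧ Route d A P K j z v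

theorem Route.mono {A : Set (α × α)} {P P' : Finset (Finset α)} {K : ℕ} (hP : P ⊆ P') {j : ℕ}
    {u v : α} (h : Route d A P K j u v) : Route d A P' K j u v := by
  induction j generalizing u with
  | zero => exact h
  | succ j ih =>
    rcases h with h | ⟨z, ⟨hz, Y, hY, hzY⟩, h⟩
    · exact Or.inl (ih h)
    · exact Or.inr ⟨z, ⟨hz, Y, hP hY, hzY⟩, ih h⟩

/-- Each level halves the link bound at the price of at most one visit to a stored chain. The number
of chains is governed by the finest level, `m = 2 ^ i`. -/
theorem exists_routes [Fintype α] [DecidableEq α] (hd : IsQuasiMetric d) {L : ℝ} (hL : 0 ≤ L)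
    (i J : ℕ) (hJ : ∀ j < J, 4 * 2 ^ (i + j) ≤ Fintype.card α) (A : Set (α × α)) :
    ∃ (N : Finset (α × α)) (P : Finset (Finset α)),
      (∀ Y ∈ P, IsGeodesicChain d L Y) ∧
      (∀ u v, d u v ≤ ENNReal.ofReal L → GeoLE d A (8 * 2 ^ (i + J)) u v →
        Route d (A ∪ N) P (8 * 2 ^ i) J u v) ∧
      (P.card : ℝ) ≤
        J * (48 * Fintype.card α * (1 + Real.log (Fintype.card α)) / ((2 : ℝ) ^ i) ^ 2) ∧
      ((∑ Y ∈ P, Y.card ^ 2 : ℕ) : ℝ) ≤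
        J * (1200 * Fintype.card α * (1 + Real.log (Fintype.card α))) ∧
      (N.card : ℝ) ≤ J * (1536 * Fintype.card α * (1 + Real.log (Fintype.card α)) ^ 2) := by
  induction J generalizing A with
  | zero => exact ⟨∅, ∅, by simp, fun u v _ h => by simpa [Route] using h, by simp, by simp, by simp⟩
  | succ J ih =>
    obtain ⟨N₁, P₁, hP₁, hcov₁, hPc₁, hPs₁, hNc₁⟩ :=
      exists_level hd hL (m := 2 ^ (i + J)) (by positivity) (hJ J (Nat.lt_succ_self J)) A
    obtain ⟨N₂, P₂, hP₂, hcov₂, hPc₂, hPs₂, hNc₂⟩ :=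
      ih (fun j hj => hJ j (by omega)) (A ∪ N₁)
    have hlog := Real.log_natCast_nonneg (Fintype.card α)
    refine ⟨N₁ ∪ N₂, P₁ ∪ P₂, ?_, ?_, ?_, ?_, ?_⟩
    · intro Y hY
      rcases Finset.mem_union.1 hY with h | h
      · exact hP₁ Y h
      · exact hP₂ Y h
    · intro u v huv h
      rw [Finset.coe_union, ← Set.union_assoc]
      have h16 : 8 * 2 ^ (i + (J + 1)) = 16 * 2 ^ (i + J) := by rw [← add_assoc, pow_succ]; ring
      rw [h16] at h
      rcases hcov₁ u v huv h with h1 | ⟨z, ⟨hz, Y, hY, hzY⟩, h1⟩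
      · exact Or.inl ((hcov₂ u v huv h1).mono Finset.subset_union_right)
      · refine Or.inr ⟨z, ⟨hz, Y, Finset.mem_union_left _ hY, hzY⟩, ?_⟩
        refine (hcov₂ z v (le_trans ?_ huv) h1).mono Finset.subset_union_right
        rw [← hz]
        exact le_add_self
    · have h1 : ((P₁ ∪ P₂).card : ℝ) ≤ P₁.card + P₂.card := by
        exact_mod_cast Finset.card_union_le _ _
      have h2 : 48 * Fintype.card α * (1 + Real.log (Fintype.card α)) /
          ((2 ^ (i + J) : ℕ) : ℝ) ^ 2 ≤
          48 * Fintype.card α * (1 + Real.log (Fintype.card α)) / ((2 : ℝ) ^ i) ^ 2 := by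
        push_cast
        gcongr
        · norm_num
        · omega
      push_cast
      linarith
    · have h1 : ((∑ Y ∈ P₁ ∪ P₂, Y.card ^ 2 : ℕ) : ℝ) ≤
          (∑ Y ∈ P₁, Y.card ^ 2 : ℕ) + (∑ Y ∈ P₂, Y.card ^ 2 : ℕ) := by
        rw [← Nat.cast_add, ← Finset.sum_union_inter]
        exact_mod_cast Nat.le_add_right _ _
      push_cast at h1 hPs₁ hPs₂ ⊢
      linarith
    · have h1 : ((N₁ ∪ N₂).card : ℝ) ≤ N₁.card + N₂.card := by
        exact_mod_cast Finset.card_union_le _ _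
      push_cast
      linarith

end Route

/-! ### Approximate paths at one distance scale. -/

section Scale

variable {α : Type*} {d : α → α → ℝ≥0∞}

/-- There is a path from `u` to `v` of at most `k` links of `A` whose `d`-length is at most `c`. -/
inductive Within (d : α → α → ℝ≥0∞) (A : Set (α × α)) : ℕ → ℝ≥0∞ → α → α → Prop
  | nil (k : ℕ) (c : ℝ≥0∞) (x : α) : Within d A k c x x
  | cons {k : ℕ} {b c : ℝ≥0∞} {x y z : α} (h : (x, y) ∈ A) (hc : d x y + b ≤ c)
      (p : Within d A k b y z) : Within d A (k + 1) c x z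

theorem Within.mono {A A' : Set (α × α)} (hA : A ⊆ A') {k k' : ℕ} {c c' : ℝ≥0∞} {u v : α}
    (h : Within d A k c u v) (hk : k ≤ k') (hc : c ≤ c') : Within d A' k' c' u v := by
  induction h generalizing k' c' with
  | nil k c x => exact .nil _ _ _
  | cons h hb p ih =>
    obtain ⟨k', rfl⟩ := Nat.exists_eq_add_of_le' (Nat.one_le_of_lt hk)
    exact .cons (hA h) (hb.trans hc) (ih (by omega) le_rfl)

theorem Within.append {A : Set (α × α)} {k l : ℕ} {b c : ℝ≥0∞} {u v w : α}
    (h₁ : Within d A k b u v) (h₂ : Within d A l c v w) : Within d A (k + l) (b + c) u w := by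
  induction h₁ with
  | nil k b x => exact h₂.mono subset_rfl (by omega) le_add_self
  | cons h hb p ih =>
    rw [Nat.add_right_comm]
    refine .cons h ?_ (ih h₂)
    rw [← add_assoc]
    gcongr

theorem Within.single {A : Set (α × α)} {x y : α} (h : (x, y) ∈ A) :
    Within d A 1 (d x y) x y :=
  .cons h (by rw [add_zero]) (.nil 0 0 y)

theorem Geo.within {A : Set (α × α)} {k : ℕ} {x y : α} (h : Geo d A k x y) :
    Within d A k (d x y) x y := by
  induction h with
  | nil x => exact .nil _ _ _
  | cons h hfin hadd p ih => exact .cons h hadd.le ih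

theorem GeoLE.within {A : Set (α × α)} {k : ℕ} {x y : α} (h : GeoLE d A k x y) :
    Within d A k (d x y) x y := by
  obtain ⟨j, hj, h⟩ := h
  exact h.within.mono subset_rfl hj le_rfl

/-- Few links from a point into a geodesic chain preserve all short distances to the chain up to
an additive error. -/
theorem IsGeodesicChain.exists_entries [DecidableEq α] {L δ : ℝ} (hL : 0 < L) (hδ : 0 < δ)
    {Y : Finset α} (hY : IsGeodesicChain d L Y) (s : α) :
    ∃ E : Finset α, E ⊆ Y ∧ (E.card : ℝ) ≤ 2 / δ + 2 ∧
      ∀ z ∈ Y, d s z ≤ ENNReal.ofReal L →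
        ∃ p ∈ E, d s p + d p z ≤ d s z + ENNReal.ofReal (δ * L) := by
  classical
  obtain ⟨t, ht, hdist⟩ := hY
  have hδL : 0 < δ * L := by positivity
  set Y' := Y.filter fun p => d s p ≤ ENNReal.ofReal L with hY'
  -- Going from `s` to `z` through an earlier `p` of the chain has excess `(d s p - t p) - (d s z -
  -- t z)`. Bucketing this quantity with width `δ * L` and entering at the first point of each
  -- bucket keeps the excess below `δ * L`.
  set c : α → ℤ := fun p => ⌊((d s p).toReal - t p) / (δ * L)⌋ with hc
  have hmin : ∀ z : α, ∃ p, z ∈ Y' → p ∈ Y' ∧ c p = c z ∧ ∀ q ∈ Y', c q = c z → t p ≤ t q := by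
    intro z
    by_cases hz : z ∈ Y'
    · obtain ⟨p, hp, hpmin⟩ := (Y'.filter fun q => c q = c z).exists_min_image t
        ⟨z, Finset.mem_filter.2 ⟨hz, rfl⟩⟩
      exact ⟨p, fun _ => ⟨(Finset.mem_filter.1 hp).1, (Finset.mem_filter.1 hp).2,
        fun q hq hqc => hpmin q (Finset.mem_filter.2 ⟨hq, hqc⟩)⟩⟩
    · exact ⟨z, fun h => absurd h hz⟩
  choose f hf using hmin
  have hrep : ∀ i : ℤ, ∃ p : α, (∃ z ∈ Y', c z = i) → p ∈ Y' ∧ c p = i ∧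
      ∀ q ∈ Y', c q = i → t p ≤ t q := by
    intro i
    by_cases h : ∃ z ∈ Y', c z = i
    · obtain ⟨z, hz, rfl⟩ := h
      exact ⟨f z, fun _ => hf z hz⟩
    · exact ⟨s, fun h' => absurd h' h⟩
  choose g hg using hrep
  refine ⟨(Y'.image c).image g, ?_, ?_, ?_⟩
  · intro p hp
    obtain ⟨i, hi, rfl⟩ := Finset.mem_image.1 hp
    obtain ⟨z, hz, rfl⟩ := Finset.mem_image.1 hi
    exact (Finset.mem_filter.1 (hg _ ⟨z, hz, rfl⟩).1).1
  -- Both the distance from `s` and the coordinate lie in `[0, L]`.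
  · have hsub : Y'.image c ⊆ Finset.Icc ⌊-(1 / δ)⌋ ⌊1 / δ⌋ := by
      intro i hi
      obtain ⟨z, hz, rfl⟩ := Finset.mem_image.1 hi
      obtain ⟨hzY, hzL⟩ := Finset.mem_filter.1 hz
      have h1 := ENNReal.toReal_le_of_le_ofReal hL.le hzL
      have h2 : 0 ≤ (d s z).toReal := ENNReal.toReal_nonneg
      obtain ⟨h3, h4⟩ := ht z hzY
      rw [Finset.mem_Icc]
      refine ⟨Int.floor_le_floor ?_, Int.floor_le_floor ?_⟩
      · rw [le_div_iff₀ hδL]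
        have : -(1 / δ) * (δ * L) = -L := by field_simp
        linarith
      · rw [div_le_iff₀ hδL]
        have : 1 / δ * (δ * L) = L := by field_simp
        linarith
    have h1 : ((Y'.image c).image g).card ≤ (⌊1 / δ⌋ + 1 - ⌊-(1 / δ)⌋).toNat :=
      Finset.card_image_le.trans ((Finset.card_le_card hsub).trans (Int.card_Icc _ _).le)
    have hle : ⌊-(1 / δ)⌋ ≤ ⌊1 / δ⌋ := by
      refine Int.floor_le_floor ?_
      have : 0 < 1 / δ := by positivity
      linarith
    have h2 : (((⌊1 / δ⌋ + 1 - ⌊-(1 / δ)⌋).toNat : ℤ) : ℝ) = ⌊1 / δ⌋ + 1 - ⌊-(1 / δ)⌋ := by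
      rw [Int.toNat_of_nonneg (by omega)]
      push_cast
      ring
    have h3 := Int.floor_le (1 / δ)
    have h4 := Int.lt_floor_add_one (-(1 / δ))
    have h5 : (((Y'.image c).image g).card : ℝ) ≤ ⌊1 / δ⌋ + 1 - ⌊-(1 / δ)⌋ := by
      rw [← h2]; exact_mod_cast h1
    have h6 : 2 / δ = 1 / δ + 1 / δ := by ring
    linarith
  · intro z hz hzL
    have hzY' : z ∈ Y' := Finset.mem_filter.2 ⟨hz, hzL⟩
    obtain ⟨hp, hpc, hpmin⟩ := hg (c z) ⟨z, hzY', rfl⟩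
    refine ⟨g (c z), Finset.mem_image_of_mem _ (Finset.mem_image_of_mem _ hzY'), ?_⟩
    generalize g (c z) = p at *
    obtain ⟨hpY, hpL⟩ := Finset.mem_filter.1 hp
    have htle := hpmin z hzY' rfl
    have hfinp : d s p ≠ ⊤ := ne_top_of_le_ne_top ENNReal.ofReal_ne_top hpL
    have hfinz : d s z ≠ ⊤ := ne_top_of_le_ne_top ENNReal.ofReal_ne_top hzL
    have habs := Int.abs_sub_lt_one_of_floor_eq_floor hpc
    rw [← sub_div, abs_div, abs_of_pos hδL, div_lt_one hδL] at habs
    have h1 := (abs_lt.1 habs).2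
    rw [hdist p hpY z hz htle, ← ENNReal.ofReal_toReal hfinp, ← ENNReal.ofReal_toReal hfinz,
      ← ENNReal.ofReal_add ENNReal.toReal_nonneg (by linarith),
      ← ENNReal.ofReal_add ENNReal.toReal_nonneg hδL.le]
    refine ENNReal.ofReal_le_ofReal ?_
    linarith

/-- Points through which every geodesic with many links passes early. -/
theorem exists_early_hittingSet [Fintype α] [DecidableEq α] (hd : IsQuasiMetric d)
    (A : Set (α × α)) (hA : ∀ u v, d u v ≠ ⊤ → ∃ k, Geo d A k u v) {b : ℕ} (hb : 0 < b) :
    ∃ S : Finset α,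
      (∀ u z, d u z ≠ ⊤ → ∃ s, GeoLE d A b u s ∧ d u s + d s z = d u z ∧
        (s = z ∨ s ∈ S ∧ minHops d A s z < minHops d A u z)) ∧
      (S.card : ℝ) ≤ 2 * (1 + Real.log (Fintype.card α)) * Fintype.card α / b := by
  classical
  have hsh : ∀ e : α × α, ∃ k X pos, d e.1 e.2 ≠ ⊤ → IsShortestVia d A e.1 e.2 k X pos := by
    intro e
    by_cases he : d e.1 e.2 ≠ ⊤
    · obtain ⟨k, hk⟩ := hA _ _ he
      obtain ⟨k, -, X, pos, h⟩ := GeoLE.exists_shortest hd ⟨k, le_rfl, hk⟩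
      exact ⟨k, X, pos, fun _ => h⟩
    · exact ⟨0, ∅, fun _ => 0, fun h => absurd h he⟩
  choose k X pos hX using hsh
  set T : Finset (α × α) := Finset.univ.filter fun e => d e.1 e.2 ≠ ⊤ ∧ b ≤ k e with hT
  -- Position `0` is left out so that moving to the hitting point strictly lowers the number of
  -- remaining links.
  set F : Finset (Finset α) := T.image fun e => (X e).filter fun p => 0 < pos e p ∧ pos e p ≤ b with hF
  have hFb : ∀ Y ∈ F, b ≤ Y.card := by
    intro Y hY
    obtain ⟨e, he, rfl⟩ := Finset.mem_image.1 hY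
    obtain ⟨he1, he2⟩ := (Finset.mem_filter.1 he).2
    have hsub : Finset.Icc 1 b ⊆
        ((X e).filter fun p => 0 < pos e p ∧ pos e p ≤ b).image (pos e) := by
      intro i hi
      have hi := Finset.mem_Icc.1 hi
      obtain ⟨x, hx, hxi⟩ := (hX e he1).exists_pos i (by omega)
      exact Finset.mem_image.2 ⟨x, Finset.mem_filter.2 ⟨hx, by omega⟩, hxi⟩
    have := (Finset.card_le_card hsub).trans Finset.card_image_le
    rwa [Nat.card_Icc, Nat.add_sub_cancel] at this
  obtain ⟨S, hS, hSc⟩ := exists_hittingSet hb F hFb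
  refine ⟨S, ?_, ?_⟩
  · intro u z huz
    by_cases hk : b ≤ k (u, z)
    · obtain ⟨s, hs, hsS⟩ := hS _ (Finset.mem_image_of_mem _
        (Finset.mem_filter.2 ⟨Finset.mem_univ (u, z), huz, hk⟩))
      obtain ⟨hs1, hs2⟩ := Finset.mem_filter.1 hs
      have hX' := hX (u, z) huz
      refine ⟨s, ⟨_, hs2.2, hX'.geo_left s hs1⟩, hX'.between_ends s hs1, Or.inr ⟨hsS, ?_⟩⟩
      obtain ⟨l, hl⟩ := hA u z huz
      have h1 : k (u, z) ≤ minHops d A u z := hX'.le_minHops ⟨l, le_rfl, hl⟩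
      have h2 : minHops d A s z ≤ k (u, z) - pos (u, z) s := minHops_le (hX'.geo_right s hs1)
      have h3 := hX'.pos_le s hs1
      omega
    · have hs := hX (u, z) huz
      obtain ⟨x, hx, -⟩ := hs.exists_pos 0 (Nat.zero_le _)
      have h1 := (hs.geo_left x hx).append hd (hs.geo_right x hx) (hs.between_ends x hx)
      refine ⟨z, ⟨_, ?_, h1⟩, by simp [hd.self], Or.inl rfl⟩
      have := hs.pos_le x hx
      omega
  · rcases isEmpty_or_nonempty α with hα | hα
    · have : S = ∅ := Finset.eq_empty_of_isEmpty S
      simp [this]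
    have hn : 0 < Fintype.card α := Fintype.card_pos
    have hn' : (0 : ℝ) < Fintype.card α := by exact_mod_cast hn
    have hb' : (0 : ℝ) < b := by exact_mod_cast hb
    have hθ : (0 : ℝ) < b / Fintype.card α := by positivity
    have hFc : F.card ≤ Fintype.card α ^ 2 := by
      refine Finset.card_image_le.trans ((Finset.card_le_univ T).trans ?_)
      rw [Fintype.card_prod, sq]
    have h1 := (greedyBound_mono hθ hFc).trans (greedyBound_le hθ _)
    push_cast at h1
    rw [Real.log_pow, div_div_eq_mul_div] at h1
    refine hSc.trans (h1.trans ?_)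
    refine div_le_div_of_nonneg_right ?_ hb'.le
    refine mul_le_mul_of_nonneg_right ?_ hn'.le
    push_cast
    linarith

/-- Following a route by links from the hitting set `S` into the chains and within the chains. -/
theorem Route.within {A A' : Set (α × α)} {P : Finset (Finset α)}
    {S : Finset α} {K b : ℕ} {L δ : ℝ} (hA : A ⊆ A')
    (hS : ∀ u z, d u z ≠ ⊤ → ∃ s, GeoLE d A b u s ∧ d u s + d s z = d u z ∧ (s = z ∨ s ∈ S))
    (hSP : ∀ s ∈ S, ∀ Y ∈ P, ∀ z ∈ Y, d s z ≤ ENNReal.ofReal L →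
      ∃ p, (s, p) ∈ A' ∧ (p, z) ∈ A' ∧ d s p + d p z ≤ d s z + ENNReal.ofReal (δ * L))
    {j : ℕ} {u v : α} (huv : d u v ≤ ENNReal.ofReal L) (h : Route d A P K j u v) :
    Within d A' (j * (b + 2) + K) (d u v + j * ENNReal.ofReal (δ * L)) u v := by
  induction j generalizing u with
  | zero => simpa [Route] using (GeoLE.within h).mono hA le_rfl le_rfl
  | succ j ih =>
    rcases h with h | ⟨z, ⟨hz, Y, hY, hzY⟩, h⟩
    · refine (ih huv h).mono subset_rfl (by rw [Nat.succ_mul]; omega) ?_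
      gcongr
      omega
    · have huz : d u z ≤ d u v := by rw [← hz]; exact le_self_add
      have hzv : d z v ≤ d u v := by rw [← hz]; exact le_add_self
      have h1 := ih (hzv.trans huv) h
      have huz' : d u z ≠ ⊤ := ne_top_of_le_ne_top ENNReal.ofReal_ne_top (huz.trans huv)
      obtain ⟨s, hs, hsz, hsS⟩ := hS u z huz'
      have h2 : Within d A' (b + 2) (d u z + ENNReal.ofReal (δ * L)) u z := by
        rcases hsS with rfl | hsS
        · exact hs.within.mono hA (by omega) le_self_add
        · have hszL : d s z ≤ ENNReal.ofReal L :=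
            le_trans (by rw [← hsz]; exact le_add_self) (huz.trans huv)
          obtain ⟨p, hp1, hp2, hp⟩ := hSP s hsS Y hY z hzY hszL
          have h3 := (hs.within.mono hA le_rfl le_rfl).append
            ((Within.single hp1).append (Within.single (d := d) hp2))
          refine h3.mono subset_rfl (by omega) ?_
          rw [← hsz, add_assoc]
          gcongr
      refine (h2.append h1).mono subset_rfl (by rw [Nat.succ_mul]; omega) ?_
      rw [← hz]
      push_cast
      refine le_of_eq ?_
      ring

end Scale

/-! ### Counting the links at one distance scale. -/

section ScaleLinks

variable {α : Type*} {d : α → α → ℝ≥0∞}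

/-- The combined links: new links, all pairs within a chain, and entries from `S` into the
chains. -/
theorem exists_links_of_routes [Fintype α] [DecidableEq α]
    {A : Set (α × α)} {N : Finset (α × α)} {P : Finset (Finset α)} {S : Finset α}
    {K b J : ℕ} {L δ : ℝ} (hL : 0 < L) (hδ : 0 < δ)
    (hP : ∀ Y ∈ P, IsGeodesicChain d L Y)
    (hS : ∀ u z, d u z ≠ ⊤ →
      ∃ s, GeoLE d (A ∪ N) b u s ∧ d u s + d s z = d u z ∧ (s = z ∨ s ∈ S)) :
    ∃ H : Finset (α × α),
      (H.card : ℝ) ≤ N.card + (∑ Y ∈ P, Y.card ^ 2 : ℕ) + S.card * P.card * (2 / δ + 2) ∧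
      ∀ u v, d u v ≤ ENNReal.ofReal L → Route d (A ∪ N) P K J u v →
        Within d (A ∪ H) (J * (b + 2) + K) (d u v + J * ENNReal.ofReal (δ * L)) u v := by
  classical
  have hE : ∀ (s : α) (Y : Finset α), ∃ E : Finset α, Y ∈ P → (E.card : ℝ) ≤ 2 / δ + 2 ∧
      E ⊆ Y ∧ ∀ z ∈ Y, d s z ≤ ENNReal.ofReal L →
        ∃ p ∈ E, d s p + d p z ≤ d s z + ENNReal.ofReal (δ * L) := by
    intro s Y
    by_cases hY : Y ∈ P
    · obtain ⟨E, h1, h2, h3⟩ := (hP Y hY).exists_entries hL hδ s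
      exact ⟨E, fun _ => ⟨h2, h1, h3⟩⟩
    · exact ⟨∅, fun h => absurd h hY⟩
  choose E hE using hE
  set H₁ : Finset (α × α) := P.biUnion fun Y => Y ×ˢ Y with hH₁
  set H₂ : Finset (α × α) := (S ×ˢ P).biUnion fun q => {q.1} ×ˢ E q.1 q.2 with hH₂
  refine ⟨N ∪ H₁ ∪ H₂, ?_, ?_⟩
  · have h1 : (H₁.card : ℝ) ≤ (∑ Y ∈ P, Y.card ^ 2 : ℕ) := by
      have : H₁.card ≤ ∑ Y ∈ P, (Y ×ˢ Y).card := Finset.card_biUnion_le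
      simp only [Finset.card_product, ← sq] at this
      exact_mod_cast this
    have h2 : (H₂.card : ℝ) ≤ S.card * P.card * (2 / δ + 2) := by
      have h : H₂.card ≤ ∑ q ∈ S ×ˢ P, (({q.1} : Finset α) ×ˢ E q.1 q.2).card :=
        Finset.card_biUnion_le
      calc (H₂.card : ℝ) ≤ ∑ q ∈ S ×ˢ P, ((({q.1} : Finset α) ×ˢ E q.1 q.2).card : ℝ) := by
            exact_mod_cast h
        _ ≤ ∑ q ∈ S ×ˢ P, (2 / δ + 2) := by
            refine Finset.sum_le_sum fun q hq => ?_
            rw [Finset.card_product, Finset.card_singleton, one_mul]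
            exact (hE q.1 q.2 (Finset.mem_product.1 hq).2).1
        _ = _ := by
            rw [Finset.sum_const, Finset.card_product, nsmul_eq_mul]
            push_cast
            ring
    have h3 : ((N ∪ H₁ ∪ H₂).card : ℝ) ≤ N.card + H₁.card + H₂.card := by
      have := Finset.card_union_le (N ∪ H₁) H₂
      have := Finset.card_union_le N H₁
      exact_mod_cast (by omega : (N ∪ H₁ ∪ H₂).card ≤ N.card + H₁.card + H₂.card)
    linarith
  · intro u v huv h
    refine h.within (S := S) ?_ hS ?_ huv
    · refine Set.union_subset_union_right _ ?_
      intro e he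
      simp only [Finset.coe_union]
      exact Or.inl (Or.inl he)
    · intro s hs Y hY z hz hsz
      obtain ⟨-, hEY, hEz⟩ := hE s Y hY
      obtain ⟨p, hp, hle⟩ := hEz z hz hsz
      refine ⟨p, Or.inr ?_, Or.inr ?_, hle⟩
      · refine Finset.mem_coe.2 (Finset.mem_union_right _ (Finset.mem_biUnion.2
          ⟨(s, Y), Finset.mem_product.2 ⟨hs, hY⟩, ?_⟩))
        exact Finset.mem_product.2 ⟨Finset.mem_singleton_self _, hp⟩
      · exact Finset.mem_coe.2 (Finset.mem_union_left _ (Finset.mem_union_right _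
          (Finset.mem_biUnion.2 ⟨Y, hY, Finset.mem_product.2 ⟨hEY hp, hz⟩⟩)))

/-- `2 ^ i` is `x` rounded down to a power of two, and `J` is the least number of doublings that
reaches `n`. Minimality gives the size condition of `exists_level` at every level and makes `J`
logarithmic. -/
theorem exists_pow_two_parameters (n : ℕ) (hn : 0 < n) {x : ℝ} (hx : 1 ≤ x) :
    ∃ i J : ℕ, (2 : ℝ) ^ i ≤ x ∧ x < 2 * 2 ^ i ∧ (∀ j < J, 4 * 2 ^ (i + j) ≤ n) ∧
      n ≤ 8 * 2 ^ (i + J) ∧ (J : ℝ) ≤ 2 * Real.log n := by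
  have hfl : ⌊x⌋₊ ≠ 0 := by
    have := Nat.le_floor (n := 1) (by simpa using hx : ((1 : ℕ) : ℝ) ≤ x)
    omega
  set i := Nat.log 2 ⌊x⌋₊ with hi
  have hex : ∃ J, n ≤ 8 * 2 ^ (i + J) := by
    refine ⟨n, ?_⟩
    have h1 : n < 2 ^ n := Nat.lt_two_pow_self
    have h2 : 2 ^ n ≤ 2 ^ (i + n) := Nat.pow_le_pow_right (by norm_num) (by omega)
    omega
  refine ⟨i, Nat.find hex, ?_, ?_, ?_, Nat.find_spec hex, ?_⟩
  · have h1 := Nat.pow_log_le_self 2 hfl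
    calc (2 : ℝ) ^ i ≤ ⌊x⌋₊ := by exact_mod_cast h1
      _ ≤ x := Nat.floor_le (by linarith)
  · have h1 := Nat.lt_pow_succ_log_self (b := 2) (by norm_num) ⌊x⌋₊
    have h2 : ⌊x⌋₊ + 1 ≤ 2 * 2 ^ i := by
      rw [← hi, pow_succ] at h1
      omega
    calc x < ⌊x⌋₊ + 1 := Nat.lt_floor_add_one x
      _ ≤ _ := by exact_mod_cast h2
  · intro j hj
    have := Nat.find_min hex hj
    omega
  · rcases hJ : Nat.find hex with _ | j
    · have := Real.log_natCast_nonneg n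
      simp only [Nat.cast_zero]
      linarith
    · have h1 := Nat.find_min hex (m := j) (by omega)
      have h2 : 2 ^ (j + 1) ≤ n := by
        have h3 : 2 ^ j ≤ 2 ^ (i + j) := Nat.pow_le_pow_right (by norm_num) (by omega)
        rw [pow_succ]
        omega
      have h3 : Real.log ((2 : ℝ) ^ (j + 1)) ≤ Real.log n :=
        Real.log_le_log (by positivity) (by exact_mod_cast h2)
      rw [Real.log_pow] at h3
      have h4 : (0.5 : ℝ) < Real.log 2 := by have := Real.log_two_gt_d9; linarith
      have h5 : ((j + 1 : ℕ) : ℝ) * 0.5 ≤ ((j + 1 : ℕ) : ℝ) * Real.log 2 := by gcongr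
      linarith

/-- A small set of links that provides, for all pairs at distance at most `L`, paths with at most
`β` links and additive error at most `η L`. -/
theorem exists_links_at_scale [Fintype α] [DecidableEq α] (hd : IsQuasiMetric d)
    (A : Set (α × α)) (hA : ∀ u v, d u v ≠ ⊤ → ∃ k, Geo d A k u v) {L η β : ℝ} (hL : 0 < L)
    (hη : 0 < η) (hη1 : η ≤ 1) (hβ : 16 * (1 + Real.log (Fintype.card α)) ≤ β) :
    ∃ H : Finset (α × α),
      (H.card : ℝ) ≤ 40000000 * ((Fintype.card α : ℝ) ^ 2 *
        (1 + Real.log (Fintype.card α)) ^ 5 / (η * β ^ 3) +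
          Fintype.card α * (1 + Real.log (Fintype.card α)) ^ 3) ∧
      ∀ u v, d u v ≤ ENNReal.ofReal L → ∃ k : ℕ, (k : ℝ) ≤ β ∧
        Within d (A ∪ H) k (d u v + ENNReal.ofReal (η * L)) u v := by
  classical
  rcases isEmpty_or_nonempty α with hα | hα
  · refine ⟨∅, ?_, fun u => hα.elim u⟩
    simp
  have hn : 0 < Fintype.card α := Fintype.card_pos
  set n := Fintype.card α with hndef
  have hlog := Real.log_natCast_nonneg n
  set Λ := 1 + Real.log n with hΛ
  have hΛ1 : 1 ≤ Λ := by linarith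
  have hn' : (0 : ℝ) < n := by exact_mod_cast hn
  have hβ0 : 0 < β := by linarith
  obtain ⟨i, J, hi1, hi2, hJ1, hJ2, hJ3⟩ :=
    exists_pow_two_parameters n hn (x := β / 16) (by linarith)
  have hJΛ : (J : ℝ) ≤ 2 * Λ := by linarith
  obtain ⟨N, P, hP, hroute, hPc, hPs, hNc⟩ := exists_routes hd hL.le i J hJ1 A
  set b := ⌊β / (16 * Λ)⌋₊ with hb
  have hx1 : 1 ≤ β / (16 * Λ) := by rw [le_div_iff₀ (by positivity)]; linarith
  have hb0 : 0 < b := Nat.floor_pos.2 hx1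
  have hb1 : (b : ℝ) ≤ β / (16 * Λ) := Nat.floor_le (by linarith)
  have hb2 : β / (32 * Λ) ≤ b := by
    have h1 := Nat.lt_floor_add_one (β / (16 * Λ))
    have h2 : (1 : ℝ) ≤ b := by exact_mod_cast hb0
    have h3 : β / (16 * Λ) = 2 * (β / (32 * Λ)) := by field_simp; norm_num
    rw [← hb] at h1
    linarith
  have hAN : A ⊆ A ∪ (N : Set (α × α)) := Set.subset_union_left
  obtain ⟨S, hS, hSc⟩ := exists_early_hittingSet hd (A ∪ N)
    (fun u v huv => (hA u v huv).imp fun k hk => hk.mono hAN) hb0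
  obtain ⟨H, hHc, hH⟩ := exists_links_of_routes (K := 8 * 2 ^ i) (J := J) (δ := η / (2 * Λ)) hL
    (by positivity) hP fun u z huz =>
      (hS u z huz).imp fun s hs => ⟨hs.1, hs.2.1, hs.2.2.imp_right And.left⟩
  refine ⟨H, ?_, ?_⟩
  · have hS' : (S.card : ℝ) ≤ 64 * Λ ^ 2 * n / β := by
      refine hSc.trans ?_
      calc 2 * Λ * n / b ≤ 2 * Λ * n / (β / (32 * Λ)) := by gcongr
        _ = _ := by field_simp; norm_num
    have hP' : (P.card : ℝ) ≤ 98304 * n * Λ ^ 2 / β ^ 2 := by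
      refine hPc.trans ?_
      have h2i : β / 32 ≤ (2 : ℝ) ^ i := by linarith
      calc (J : ℝ) * (48 * n * Λ / ((2 : ℝ) ^ i) ^ 2)
          ≤ (2 * Λ) * (48 * n * Λ / (β / 32) ^ 2) := by gcongr
        _ = _ := by field_simp; norm_num
    have hδ' : 2 / (η / (2 * Λ)) + 2 ≤ 6 * Λ / η := by
      have h1 : 2 / (η / (2 * Λ)) = 4 * Λ / η := by field_simp; norm_num
      have h2 : 2 ≤ 2 * Λ / η := by rw [le_div_iff₀ hη]; nlinarith
      have h3 : 6 * Λ / η = 4 * Λ / η + 2 * Λ / η := by ring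
      linarith
    have hSP : (S.card : ℝ) * P.card * (2 / (η / (2 * Λ)) + 2) ≤
        40000000 * ((n : ℝ) ^ 2 * Λ ^ 5 / (η * β ^ 3)) := by
      calc (S.card : ℝ) * P.card * (2 / (η / (2 * Λ)) + 2)
          ≤ (64 * Λ ^ 2 * n / β) * (98304 * n * Λ ^ 2 / β ^ 2) * (6 * Λ / η) := by gcongr
        _ = 37748736 * ((n : ℝ) ^ 2 * Λ ^ 5 / (η * β ^ 3)) := by field_simp; norm_num
        _ ≤ _ := by
          refine mul_le_mul_of_nonneg_right (by norm_num) ?_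
          positivity
    have hN' : (N.card : ℝ) ≤ 3072 * (n * Λ ^ 3) := by
      refine hNc.trans ?_
      calc (J : ℝ) * (1536 * n * Λ ^ 2) ≤ (2 * Λ) * (1536 * n * Λ ^ 2) := by gcongr
        _ = _ := by ring
    have hPs' : ((∑ Y ∈ P, Y.card ^ 2 : ℕ) : ℝ) ≤ 2400 * (n * Λ ^ 3) := by
      refine hPs.trans ?_
      calc (J : ℝ) * (1200 * n * Λ) ≤ (2 * Λ) * (1200 * n * Λ) := by gcongr
        _ = 2400 * (n * (Λ ^ 2 * 1)) := by ring
        _ ≤ 2400 * (n * (Λ ^ 2 * Λ)) := by gcongr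
        _ = _ := by ring
    have h0 : 0 ≤ (n : ℝ) * Λ ^ 3 := by positivity
    linarith
  · intro u v huv
    have hfin : d u v ≠ ⊤ := ne_top_of_le_ne_top ENNReal.ofReal_ne_top huv
    obtain ⟨k, hk⟩ := hA u v hfin
    obtain ⟨k, -, X, pos, hX⟩ := GeoLE.exists_shortest hd ⟨k, le_rfl, hk⟩
    -- A fewest-link chain does not repeat vertices, so it has fewer than `n ≤ 8 * 2 ^ (i + J)`
    -- links and the routes apply.
    have hkn : k + 1 ≤ n := by rw [← hX.card]; exact Finset.card_le_univ X
    obtain ⟨x, hx, -⟩ := hX.exists_pos 0 (Nat.zero_le _)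
    have hgeo := (hX.geo_left x hx).append hd (hX.geo_right x hx) (hX.between_ends x hx)
    have hpk := hX.pos_le x hx
    have h1 := hH u v huv (hroute u v huv ⟨_, by omega, hgeo⟩)
    refine ⟨_, ?_, h1.mono subset_rfl le_rfl ?_⟩
    -- The final chain takes `8 * 2 ^ i ≤ β / 2` links, the visits at most `β / 8 + 4 * Λ ≤ 3 * β /
    -- 8`.
    · push_cast
      have h2 : (J : ℝ) * (b + 2) ≤ (2 * Λ) * (β / (16 * Λ) + 2) := by gcongr
      have h3 : (2 * Λ) * (β / (16 * Λ) + 2) = β / 8 + 4 * Λ := by field_simp; ring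
      linarith
    · gcongr
      rw [← ENNReal.ofReal_natCast, ← ENNReal.ofReal_mul (by positivity)]
      refine ENNReal.ofReal_le_ofReal ?_
      calc (J : ℝ) * (η / (2 * Λ) * L) ≤ (2 * Λ) * (η / (2 * Λ) * L) := by gcongr
        _ = η * L := by field_simp

end ScaleLinks

/-! ### All distance scales together. -/

section AllScales

variable {α : Type*} {d : α → α → ℝ≥0∞}

/-- A small set of links that provides paths with few links and small relative error for all
pairs. -/
theorem exists_links [Fintype α] [DecidableEq α] (hd : IsQuasiMetric d)
    (A : Set (α × α)) (hA : ∀ u v, d u v ≠ ⊤ → ∃ k, Geo d A k u v)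
    (hd1 : ∀ u v, u ≠ v → 1 ≤ d u v) {D : ℕ} (hD0 : 0 < D)
    (hD : ∀ u v, d u v ≠ ⊤ → d u v ≤ D) {ε β : ℝ}
    (hε : 0 < ε) (hε1 : ε < 1) (hβ : 16 * (1 + Real.log (Fintype.card α)) ≤ β) :
    ∃ H : Finset (α × α),
      (H.card : ℝ) ≤ (2 + 2 * Real.log D) * (40000000 * ((Fintype.card α : ℝ) ^ 2 *
        (1 + Real.log (Fintype.card α)) ^ 5 / (ε / 2 * β ^ 3) +
          Fintype.card α * (1 + Real.log (Fintype.card α)) ^ 3)) ∧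
      ∀ u v, d u v ≠ ⊤ → ∃ k : ℕ, (k : ℝ) ≤ β ∧
        Within d (A ∪ H) k (ENNReal.ofReal (1 + ε) * d u v) u v := by
  classical
  have hlog := Real.log_natCast_nonneg (Fintype.card α)
  have hβ0 : 0 ≤ β := by linarith
  set M : ℝ := 40000000 * ((Fintype.card α : ℝ) ^ 2 *
        (1 + Real.log (Fintype.card α)) ^ 5 / (ε / 2 * β ^ 3) +
          Fintype.card α * (1 + Real.log (Fintype.card α)) ^ 3) with hM
  have hM0 : 0 ≤ M := by positivity
  choose H hHc hH using fun k : ℕ => exists_links_at_scale hd A hA (L := 2 ^ k) (η := ε / 2)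
    (β := β) (by positivity) (by positivity) (by linarith) hβ
  set K := Nat.log 2 D + 2 with hK
  refine ⟨(Finset.range K).biUnion H, ?_, ?_⟩
  · have h1 : (((Finset.range K).biUnion H).card : ℝ) ≤ ∑ k ∈ Finset.range K, ((H k).card : ℝ) := by
      exact_mod_cast Finset.card_biUnion_le
    have h2 : ∑ k ∈ Finset.range K, ((H k).card : ℝ) ≤ K * M := by
      calc _ ≤ ∑ k ∈ Finset.range K, M := Finset.sum_le_sum fun k _ => hHc k
        _ = _ := by simp
    have h3 : (K : ℝ) ≤ 2 + 2 * Real.log D := by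
      have h4 : Real.log ((2 : ℝ) ^ Nat.log 2 D) ≤ Real.log D :=
        Real.log_le_log (by positivity) (by exact_mod_cast Nat.pow_log_le_self 2 hD0.ne')
      rw [Real.log_pow] at h4
      have h5 : (0.5 : ℝ) < Real.log 2 := by have := Real.log_two_gt_d9; linarith
      have h6 : (Nat.log 2 D : ℝ) * 0.5 ≤ (Nat.log 2 D : ℝ) * Real.log 2 := by gcongr
      rw [hK]
      push_cast
      linarith
    exact h1.trans (h2.trans (mul_le_mul_of_nonneg_right h3 hM0))
  · intro u v huv
    by_cases huv' : u = v
    · subst huv'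
      exact ⟨0, by simpa using hβ0, .nil _ _ _⟩
    have hex : ∃ k : ℕ, d u v ≤ ENNReal.ofReal (2 ^ k) ∧ k < K := by
      refine ⟨Nat.log 2 D + 1, (hD u v huv).trans ?_, by omega⟩
      rw [← ENNReal.ofReal_natCast]
      refine ENNReal.ofReal_le_ofReal ?_
      exact_mod_cast (Nat.lt_pow_succ_log_self (b := 2) (by norm_num) D).le
    obtain ⟨hk1, hk2⟩ := Nat.find_spec hex
    set k := Nat.find hex with hk
    obtain ⟨l, hl, hw⟩ := hH k u v hk1
    refine ⟨l, hl, hw.mono ?_ le_rfl ?_⟩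
    · refine Set.union_subset_union_right _ ?_
      exact_mod_cast Finset.subset_biUnion_of_mem H (Finset.mem_range.2 hk2)
    -- `k` is the first scale above `d u v`, hence at most twice too large; at `k = 0` this uses `1
    -- ≤ d u v`. Error `ε / 2` relative to the scale is then `ε` relative to the distance.
    · have h1 : ENNReal.ofReal (2 ^ k) ≤ 2 * d u v := by
        rcases hk0 : k with _ | j
        · simp only [pow_zero, ENNReal.ofReal_one]
          calc (1 : ℝ≥0∞) ≤ d u v := hd1 u v huv'
            _ ≤ 2 * d u v := le_mul_of_one_le_left' one_le_two
        · have h2 := Nat.find_min hex (m := j) (by omega)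
          have h3 : ENNReal.ofReal (2 ^ j) ≤ d u v := by
            by_contra hc
            exact h2 ⟨(not_le.1 hc).le, by omega⟩
          rw [pow_succ, mul_comm, ENNReal.ofReal_mul (by norm_num)]
          have : ENNReal.ofReal 2 = 2 := by simp
          rw [this]
          gcongr
      rw [ENNReal.ofReal_add zero_le_one hε.le, ENNReal.ofReal_one, add_mul, one_mul]
      gcongr
      calc ENNReal.ofReal (ε / 2 * 2 ^ k) = ENNReal.ofReal (ε / 2) * ENNReal.ofReal (2 ^ k) :=
            ENNReal.ofReal_mul (by positivity)
        _ ≤ ENNReal.ofReal (ε / 2) * (2 * d u v) := by gcongr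
        _ = ENNReal.ofReal ε * d u v := by
            rw [← mul_assoc]
            congr 1
            rw [show (2 : ℝ≥0∞) = ENNReal.ofReal 2 by simp, ← ENNReal.ofReal_mul (by positivity)]
            congr 1
            ring

end AllScales

/-! ### Passing to a sample of the points. -/

section Sampling

variable {α : Type*} {d : α → α → ℝ≥0∞}

/-- The pairs of points of `S` that are joined by a geodesic chain of at most `b` links. -/
def shortPairs (d : α → α → ℝ≥0∞) (A : Set (α × α)) (b : ℕ) (S : Finset α) : Set (S × S) :=
  {e | GeoLE d A b e.1 e.2}

/-- The early hitting point is taken again and again from the current sample point. The fewest-link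
count to `v` falls each time, so the walk ends within `b` links of `v` without leaving a geodesic.
-/
theorem exists_shortPairs_chain (hd : IsQuasiMetric d) {A : Set (α × α)} {b : ℕ} {S : Finset α}
    (hS : ∀ u z, d u z ≠ ⊤ → ∃ s, GeoLE d A b u s ∧ d u s + d s z = d u z ∧
      (s = z ∨ s ∈ S ∧ minHops d A s z < minHops d A u z)) (v : α) (s : S) (hsv : d s v ≠ ⊤) :
    ∃ t : S, (∃ k, Geo (fun x y : S => d x y) (shortPairs d A b S) k s t) ∧
      d s t + d t v = d s v ∧ GeoLE d A b t v := by
  induction hm : minHops d A s v using Nat.strong_induction_on generalizing s with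
  | _ m ih =>
    obtain ⟨s', hs', hadd, rfl | ⟨hs'S, hlt⟩⟩ := hS s v hsv
    · exact ⟨s, ⟨0, .nil s⟩, by simp [hd.self], hs'⟩
    · have hss' : d s s' ≠ ⊤ := ne_top_of_le_ne_top hsv (by rw [← hadd]; exact le_self_add)
      have hs'v : d s' v ≠ ⊤ := ne_top_of_le_ne_top hsv (by rw [← hadd]; exact le_add_self)
      obtain ⟨t, ⟨k, hk⟩, ht, htv⟩ := ih _ (hm ▸ hlt) ⟨s', hs'S⟩ hs'v rfl
      simp only at ht
      have hst : d s s' + d s' t = d s t := by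
        refine le_antisymm ?_ (hd.triangle _ _ _)
        have htv' : d t v ≠ ⊤ := ne_top_of_le_ne_top hs'v (by rw [← ht]; exact le_add_self)
        have h := hd.triangle s t v
        rw [← hadd, ← ht, ← add_assoc] at h
        exact (ENNReal.add_le_add_iff_right htv').1 h
      have hmem : (s, ⟨s', hs'S⟩) ∈ shortPairs d A b S := hs'
      refine ⟨t, ⟨k + 1, .cons hmem hss' hst hk⟩, ?_, htv⟩
      rw [← hst, add_assoc, ht, hadd]

theorem Within.of_shortPairs {A : Set (α × α)} {b : ℕ} (hb : 0 < b)
    {S : Finset α} {H : Set (S × S)} {H' : Set (α × α)}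
    (hH : ∀ e ∈ H, ((e.1 : α), (e.2 : α)) ∈ H') {k : ℕ} {c : ℝ≥0∞} {x y : S}
    (h : Within (fun x y : S => d x y) (shortPairs d A b S ∪ H) k c x y) :
    Within d (A ∪ H') (b * k) c x y := by
  induction h with
  | nil k c x => exact .nil _ _ _
  | @cons k b' c x y z h hc p ih =>
    rw [Nat.mul_succ, Nat.add_comm]
    have h1 : Within d (A ∪ H') b (d x y) x y := by
      rcases h with h | h
      · exact (GeoLE.within h).mono Set.subset_union_left le_rfl le_rfl
      · exact (Within.single (Or.inr (hH _ h))).mono subset_rfl hb le_rfl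
    exact (h1.append ih).mono subset_rfl le_rfl hc

/-- Links between the points of a hitting set for all geodesics with `b` links. -/
theorem exists_links_of_sampling [Fintype α] [DecidableEq α] (hd : IsQuasiMetric d)
    (A : Set (α × α)) (hA : ∀ u v, d u v ≠ ⊤ → ∃ k, Geo d A k u v)
    (hd1 : ∀ u v, u ≠ v → 1 ≤ d u v) {D : ℕ} (hD0 : 0 < D)
    (hD : ∀ u v, d u v ≠ ⊤ → d u v ≤ D) {ε β : ℝ}
    (hε : 0 < ε) (hε1 : ε < 1) {b : ℕ} (hb : 0 < b)
    (hβ : 16 * (1 + Real.log (Fintype.card α)) ≤ β) :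
    ∃ (m : ℕ) (H : Finset (α × α)), m ≤ Fintype.card α ∧
      (m : ℝ) ≤ 2 * (1 + Real.log (Fintype.card α)) * Fintype.card α / b ∧
      (H.card : ℝ) ≤ (2 + 2 * Real.log D) * (40000000 * ((m : ℝ) ^ 2 *
        (1 + Real.log (Fintype.card α)) ^ 5 / (ε / 2 * β ^ 3) +
          m * (1 + Real.log (Fintype.card α)) ^ 3)) ∧
      ∀ u v, d u v ≠ ⊤ → ∃ k : ℕ, (k : ℝ) ≤ b * (β + 2) ∧
        Within d (A ∪ H) k (ENNReal.ofReal (1 + ε) * d u v) u v := by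
  classical
  obtain ⟨S, hS, hSc⟩ := exists_early_hittingSet hd A hA hb
  have hSn : S.card ≤ Fintype.card α := Finset.card_le_univ S
  have hcard : Fintype.card S = S.card := Fintype.card_coe S
  have hlogS : Real.log S.card ≤ Real.log (Fintype.card α) := by
    rcases Nat.eq_zero_or_pos S.card with h | h
    · rw [h, Nat.cast_zero, Real.log_zero]
      exact Real.log_natCast_nonneg _
    · exact Real.log_le_log (by exact_mod_cast h) (by exact_mod_cast hSn)
  have hlogS0 := Real.log_natCast_nonneg S.card
  have hlogD := Real.log_natCast_nonneg D
  have hβ0 : 0 < β := by linarith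
  have hdS : IsQuasiMetric fun x y : S => d x y :=
    ⟨fun x => hd.self _, fun x y z => hd.triangle _ _ _,
      fun x y h => Subtype.ext (hd.eq_of_eq_zero _ _ h)⟩
  -- If the target is itself a sample point, the last stretch is also a short pair, so the
  -- restricted quasi-metric is again geodesic.
  have hAS : ∀ u v : S, d u v ≠ ⊤ →
      ∃ k, Geo (fun x y : S => d x y) (shortPairs d A b S) k u v := by
    intro u v huv
    obtain ⟨t, ⟨k, hk⟩, hadd, htv⟩ := exists_shortPairs_chain hd hS v u huv
    have htv' : d t v ≠ ⊤ := ne_top_of_le_ne_top huv (by rw [← hadd]; exact le_add_self)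
    exact ⟨k + 1, hk.append hdS (Geo.single hdS htv htv') hadd⟩
  obtain ⟨H, hHc, hH⟩ := exists_links hdS (shortPairs d A b S) hAS
    (fun u v huv => hd1 _ _ fun h => huv (Subtype.ext h)) hD0 (fun u v => hD u v) hε hε1
    (β := β) (by rw [hcard]; linarith)
  set H' : Finset (α × α) := H.image fun e => ((e.1 : α), (e.2 : α)) with hH'
  have hHH' : ∀ e ∈ (H : Set (S × S)), ((e.1 : α), (e.2 : α)) ∈ (H' : Set (α × α)) :=
    fun e he => Finset.mem_coe.2 (Finset.mem_image_of_mem _ (Finset.mem_coe.1 he))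
  refine ⟨S.card, H', hSn, hSc, ?_, ?_⟩
  · have h1 : (H'.card : ℝ) ≤ H.card := by exact_mod_cast Finset.card_image_le
    refine h1.trans (hHc.trans ?_)
    rw [hcard]
    gcongr
  · intro u v huv
    obtain ⟨s, hus, hadd, hs⟩ := hS u v huv
    have hε' : 1 ≤ ENNReal.ofReal (1 + ε) := by
      rw [← ENNReal.ofReal_one]
      exact ENNReal.ofReal_le_ofReal (by linarith)
    have hb' : (0 : ℝ) < b := by exact_mod_cast hb
    rcases hs with rfl | ⟨hsS, -⟩
    · refine ⟨b, by nlinarith, hus.within.mono Set.subset_union_left le_rfl ?_⟩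
      exact le_mul_of_one_le_left' hε'
    · have hsv : d s v ≠ ⊤ := ne_top_of_le_ne_top huv (by rw [← hadd]; exact le_add_self)
      obtain ⟨t, -, ht, htv⟩ := exists_shortPairs_chain hd hS v ⟨s, hsS⟩ hsv
      simp only at ht
      have hst : d s t ≠ ⊤ := ne_top_of_le_ne_top hsv (by rw [← ht]; exact le_self_add)
      obtain ⟨k, hk, hw⟩ := hH ⟨s, hsS⟩ t hst
      have hw' := Within.of_shortPairs hb hHH' hw
      have h1 := ((hus.within.mono (Set.subset_union_left (t := (H' : Set (α × α)))) le_rfl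
        le_rfl).append hw').append
          (htv.within.mono (Set.subset_union_left (t := (H' : Set (α × α)))) le_rfl le_rfl)
      refine ⟨_, ?_, h1.mono subset_rfl le_rfl ?_⟩
      -- At most `b` links into the sample, `b` per link inside it, and `b` out of it.
      · push_cast
        nlinarith
      · calc d u s + ENNReal.ofReal (1 + ε) * d s t + d t v
            ≤ ENNReal.ofReal (1 + ε) * d u s + ENNReal.ofReal (1 + ε) * d s t +
              ENNReal.ofReal (1 + ε) * d t v := by
              gcongr
              · exact le_mul_of_one_le_left' hε'
              · exact le_mul_of_one_le_left' hε'
          _ = ENNReal.ofReal (1 + ε) * d u v := by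
              rw [← hadd, ← ht]; ring

/-- All links between the points of a hitting set. -/
theorem exists_complete_links [Fintype α] [DecidableEq α] (hd : IsQuasiMetric d)
    (A : Set (α × α)) (hA : ∀ u v, d u v ≠ ⊤ → ∃ k, Geo d A k u v) {b : ℕ} (hb : 0 < b) :
    ∃ (m : ℕ) (H : Finset (α × α)), m ≤ Fintype.card α ∧
      (m : ℝ) ≤ 2 * (1 + Real.log (Fintype.card α)) * Fintype.card α / b ∧
      H.card ≤ m ^ 2 ∧
      ∀ u v, d u v ≠ ⊤ → Within d (A ∪ H) (2 * b + 1) (d u v) u v := by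
  classical
  obtain ⟨S, hS, hSc⟩ := exists_early_hittingSet hd A hA hb
  refine ⟨S.card, S ×ˢ S, Finset.card_le_univ S, hSc, by rw [Finset.card_product, sq], ?_⟩
  intro u v huv
  obtain ⟨s, hus, hadd, hs⟩ := hS u v huv
  rcases hs with rfl | ⟨hsS, -⟩
  · exact hus.within.mono Set.subset_union_left (by omega) le_rfl
  · have hsv : d s v ≠ ⊤ := ne_top_of_le_ne_top huv (by rw [← hadd]; exact le_add_self)
    obtain ⟨t, -, ht, htv⟩ := exists_shortPairs_chain hd hS v ⟨s, hsS⟩ hsv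
    simp only at ht
    have hmem : (s, (t : α)) ∈ A ∪ ((S ×ˢ S : Finset (α × α)) : Set (α × α)) :=
      Or.inr (Finset.mem_coe.2 (Finset.mem_product.2 ⟨hsS, t.2⟩))
    have hA' : A ⊆ A ∪ ((S ×ˢ S : Finset (α × α)) : Set (α × α)) := Set.subset_union_left
    have h1 := ((hus.within.mono hA' le_rfl le_rfl).append (Within.single hmem)).append
      (htv.within.mono hA' le_rfl le_rfl)
    refine h1.mono subset_rfl (by omega) ?_
    rw [add_assoc, ht, hadd]

end Sampling

/-! ### From weighted digraphs to quasi-metrics and back. -/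

namespace WeightedDigraph

variable {V : Type*} {G : WeightedDigraph V} {W : ℕ}

/-- Concatenation of walks. -/
def Walk.append {u v w : V} : G.Walk u v → G.Walk v w → G.Walk u w
  | .nil _, q => q
  | .cons h p, q => .cons h (p.append q)

theorem Walk.length_append {u v w : V} (p : G.Walk u v) (q : G.Walk v w) :
    (p.append q).length = p.length + q.length := by
  induction p with
  | nil u => simp [Walk.append, Walk.length]
  | cons h p ih => simp only [Walk.append, Walk.length, ih, add_assoc]

theorem dist_le_length {u v : V} (p : G.Walk u v) : G.dist u v ≤ p.length := iInf_le _ p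

theorem dist_self (u : V) : G.dist u u = 0 :=
  le_antisymm (dist_le_length (.nil u)) zero_le

theorem dist_triangle (u v w : V) : G.dist u w ≤ G.dist u v + G.dist v w := by
  unfold dist
  rw [ENNReal.iInf_add]
  refine le_iInf fun p => ?_
  rw [ENNReal.add_iInf]
  refine le_iInf fun q => ?_
  rw [← Walk.length_append]
  exact iInf_le _ _

theorem dist_le_weight {u v : V} (h : G.Adj u v) : G.dist u v ≤ G.weight u v := by
  simpa [Walk.length] using dist_le_length (Walk.cons h (.nil v))

theorem HasIntegerWeights.exists_length_eq (hG : G.HasIntegerWeights W) {u v : V}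
    (p : G.Walk u v) : ∃ k : ℕ, p.length = k := by
  induction p with
  | nil u => exact ⟨0, by simp [Walk.length]⟩
  | cons h p ih =>
    obtain ⟨k, hk⟩ := ih
    obtain ⟨l, -, -, hl⟩ := hG _ _ h
    exact ⟨l + k, by simp [Walk.length, hk, hl]⟩

/-- Walk lengths are natural numbers, so the infimum is attained. -/
theorem HasIntegerWeights.exists_length_eq_dist (hG : G.HasIntegerWeights W) {u v : V}
    (h : G.Reachable u v) : ∃ p : G.Walk u v, p.length = G.dist u v ∧ p.length ≠ ⊤ := by
  classical
  obtain ⟨p₀⟩ := h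
  have hex : ∃ k : ℕ, ∃ p : G.Walk u v, p.length = k :=
    (hG.exists_length_eq p₀).imp fun k hk => ⟨p₀, hk⟩
  obtain ⟨p, hp⟩ := Nat.find_spec hex
  refine ⟨p, le_antisymm ?_ (dist_le_length p), by simp [hp]⟩
  refine le_iInf fun q => ?_
  obtain ⟨k, hk⟩ := hG.exists_length_eq q
  rw [hp, hk]
  exact_mod_cast Nat.find_min' hex ⟨q, hk⟩

theorem HasIntegerWeights.one_le_dist (hG : G.HasIntegerWeights W) {u v : V} (huv : u ≠ v) :
    1 ≤ G.dist u v := by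
  refine le_iInf fun p => ?_
  cases p with
  | nil => exact absurd rfl huv
  | cons h p =>
    obtain ⟨l, hl1, -, hl⟩ := hG _ _ h
    rw [Walk.length, hl]
    exact le_add_right (by exact_mod_cast hl1)

theorem HasIntegerWeights.isQuasiMetric (hG : G.HasIntegerWeights W) : IsQuasiMetric G.dist where
  self := dist_self
  triangle := dist_triangle
  eq_of_eq_zero x y h := by
    by_contra hxy
    have := hG.one_le_dist hxy
    rw [h] at this
    simp at this

theorem reachable_of_dist_ne_top {u v : V} (h : G.dist u v ≠ ⊤) : G.Reachable u v := by
  by_contra hc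
  have : IsEmpty (G.Walk u v) := not_nonempty_iff.1 hc
  exact h (by rw [dist, iInf_of_empty])

theorem HasIntegerWeights.dist_ne_top (hG : G.HasIntegerWeights W) {u v : V}
    (h : G.Reachable u v) : G.dist u v ≠ ⊤ := by
  obtain ⟨p, hp, hfin⟩ := hG.exists_length_eq_dist h
  rwa [← hp]

/-- The edges that are shortest paths. -/
def tightEdges (G : WeightedDigraph V) : Set (V × V) :=
  {e | G.Adj e.1 e.2 ∧ G.weight e.1 e.2 = G.dist e.1 e.2}

/-- In a shortest walk the triangle inequality leaves no slack: the first edge realizes its distance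
and the rest is again shortest. -/
theorem Walk.geo {u v : V} (p : G.Walk u v) (hp : p.length = G.dist u v) (hfin : p.length ≠ ⊤) :
    Geo G.dist G.tightEdges p.hops u v := by
  induction p with
  | nil u => exact .nil u
  | @cons u v w h p ih =>
    rw [Walk.length] at hp hfin
    have hw : G.weight u v ≠ ⊤ := h
    have hpfin : p.length ≠ ⊤ := fun hc => hfin (by simp [hc])
    have h1 := dist_le_weight h
    have h2 := dist_triangle (G := G) u v w
    have h3 := dist_le_length p
    have h4 : G.dist v w ≠ ⊤ := ne_top_of_le_ne_top hpfin h3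
    have h5 : p.length = G.dist v w := by
      refine le_antisymm ?_ h3
      refine (ENNReal.add_le_add_iff_left hw).1 ?_
      rw [hp]
      exact h2.trans (by gcongr)
    have h6 : G.weight u v = G.dist u v := by
      refine le_antisymm ?_ h1
      refine (ENNReal.add_le_add_iff_right h4).1 ?_
      rwa [← h5, hp, h5]
    exact .cons (show (u, v) ∈ G.tightEdges from ⟨h, h6⟩) (h6 ▸ hw) (by rw [← h6, ← h5, hp])
      (ih h5 hpfin)

theorem HasIntegerWeights.exists_geo (hG : G.HasIntegerWeights W) {u v : V}
    (h : G.dist u v ≠ ⊤) : ∃ k, Geo G.dist G.tightEdges k u v := by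
  obtain ⟨p, hp, hfin⟩ := hG.exists_length_eq_dist (reachable_of_dist_ne_top h)
  exact ⟨_, p.geo hp hfin⟩

theorem HasIntegerWeights.dist_le_of_geo (hG : G.HasIntegerWeights W) {k : ℕ} {u v : V}
    (h : Geo G.dist G.tightEdges k u v) : G.dist u v ≤ (k * W : ℕ) := by
  induction h with
  | nil x => simp [dist_self]
  | @cons k x y z h hfin hadd p ih =>
    obtain ⟨l, -, hl, hw⟩ := hG _ _ h.1
    have h1 : G.dist x y ≤ W := by
      rw [← h.2, hw]
      exact_mod_cast hl
    rw [← hadd, Nat.succ_mul, Nat.add_comm, Nat.cast_add]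
    exact add_le_add h1 ih

theorem HasIntegerWeights.exists_geo_lt_card [Fintype V] (hG : G.HasIntegerWeights W) {u v : V}
    (h : G.dist u v ≠ ⊤) : ∃ k < Fintype.card V, Geo G.dist G.tightEdges k u v := by
  have hd := hG.isQuasiMetric
  obtain ⟨k, hk⟩ := hG.exists_geo h
  obtain ⟨k, -, X, pos, hX⟩ := GeoLE.exists_shortest hd ⟨k, le_rfl, hk⟩
  obtain ⟨x, hx, -⟩ := hX.exists_pos 0 (Nat.zero_le _)
  have h1 := (hX.geo_left x hx).append hd (hX.geo_right x hx) (hX.between_ends x hx)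
  have h2 := hX.card
  have h3 := Finset.card_le_univ X
  have h4 := hX.pos_le x hx
  exact ⟨_, by omega, h1⟩

theorem HasIntegerWeights.dist_le [Fintype V] (hG : G.HasIntegerWeights W) {u v : V}
    (h : G.dist u v ≠ ⊤) : G.dist u v ≤ (Fintype.card V * W : ℕ) := by
  obtain ⟨k, hk, hgeo⟩ := hG.exists_geo_lt_card h
  refine (hG.dist_le_of_geo hgeo).trans ?_
  exact_mod_cast Nat.mul_le_mul_right W hk.le

open Classical in
/-- The graph whose edges are the pairs in `H`, weighted by their distance in `G`. -/
noncomputable def shortcuts (G : WeightedDigraph V) (H : Finset (V × V)) : WeightedDigraph V where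
  weight u v := if (u, v) ∈ H then G.dist u v else ⊤

theorem ncard_edgeSet_shortcuts_le (G : WeightedDigraph V) (H : Finset (V × V)) :
    (G.shortcuts H).edgeSet.ncard ≤ H.card := by
  have hsub : (G.shortcuts H).edgeSet ⊆ (H : Set (V × V)) := by
    rintro ⟨u, v⟩ h
    by_contra hc
    exact h (if_neg hc)
  rw [← Set.ncard_coe_finset]
  exact Set.ncard_le_ncard hsub H.finite_toSet

/-- No edge of the union is lighter than the distance it spans. -/
theorem dist_le_length_of_union_shortcuts {H : Finset (V × V)} {u v : V}
    (p : (G.union (G.shortcuts H)).Walk u v) : G.dist u v ≤ p.length := by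
  induction p with
  | nil u => simp [dist_self]
  | @cons u v w h p ih =>
    refine (dist_triangle u v w).trans (add_le_add ?_ ih)
    refine le_min ?_ ?_
    · by_cases h : G.Adj u v
      · exact dist_le_weight h
      · rw [not_not.1 h]; exact le_top
    · unfold shortcuts
      simp only
      split_ifs
      · exact le_rfl
      · exact le_top

theorem exists_walk_union (G' : WeightedDigraph V) {u v : V} (p : G.Walk u v) :
    ∃ q : (G.union G').Walk u v, q.length ≤ p.length := by
  induction p with
  | nil u => exact ⟨.nil u, le_rfl⟩
  | @cons u v w h p ih =>
    obtain ⟨q, hq⟩ := ih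
    have hle : (G.union G').weight u v ≤ G.weight u v := min_le_left _ _
    exact ⟨.cons (ne_top_of_le_ne_top h hle) q, add_le_add hle hq⟩

theorem dist_union_shortcuts (G : WeightedDigraph V) (H : Finset (V × V)) (u v : V) :
    G.dist u v = (G.union (G.shortcuts H)).dist u v := by
  refine le_antisymm (le_iInf fun p => dist_le_length_of_union_shortcuts p) ?_
  refine le_iInf fun p => ?_
  obtain ⟨q, hq⟩ := exists_walk_union (G.shortcuts H) p
  exact (dist_le_length q).trans hq

theorem exists_walk_of_within {H : Finset (V × V)} {k : ℕ} {c : ℝ≥0∞} {u v : V}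
    (h : Within G.dist (G.tightEdges ∪ H) k c u v) (hc : c ≠ ⊤) :
    ∃ p : (G.union (G.shortcuts H)).Walk u v, p.hops ≤ k ∧ p.length ≤ c := by
  induction h with
  | nil k c x => exact ⟨.nil x, Nat.zero_le _, zero_le⟩
  | @cons k b c x y z h hbc p ih =>
    have hsum : G.dist x y + b ≠ ⊤ := ne_top_of_le_ne_top hc hbc
    obtain ⟨h1, h2⟩ := ENNReal.add_ne_top.1 hsum
    obtain ⟨q, hq1, hq2⟩ := ih h2
    have hle : (G.union (G.shortcuts H)).weight x y ≤ G.dist x y := by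
      rcases h with h | h
      · exact (min_le_left _ _).trans h.2.le
      · exact (min_le_right _ _).trans (le_of_eq (if_pos h))
    refine ⟨.cons (ne_top_of_le_ne_top h1 hle) q, ?_, ?_⟩
    · simpa [Walk.hops] using hq1
    · exact (add_le_add hle hq2).trans hbc

theorem HasIntegerWeights.isHopset_shortcuts (hG : G.HasIntegerWeights W) {H : Finset (V × V)}
    {β ε : ℝ}
    (h : ∀ u v, G.dist u v ≠ ⊤ → ∃ k : ℕ, (k : ℝ) ≤ β ∧
      Within G.dist (G.tightEdges ∪ H) k (ENNReal.ofReal (1 + ε) * G.dist u v) u v) :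
    G.IsHopset (G.shortcuts H) β ε := by
  refine ⟨dist_union_shortcuts G H, fun u v huv => ?_⟩
  have hfin := hG.dist_ne_top huv
  obtain ⟨k, hk, hw⟩ := h u v hfin
  obtain ⟨p, hp1, hp2⟩ := exists_walk_of_within hw (ENNReal.mul_ne_top ENNReal.ofReal_ne_top hfin)
  exact ⟨p, le_trans (by exact_mod_cast hp1) hk, hp2⟩

theorem le_ofReal_one_add_mul {ε : ℝ} (hε : 0 < ε) (c : ℝ≥0∞) :
    c ≤ ENNReal.ofReal (1 + ε) * c := by
  refine le_mul_of_one_le_left' ?_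
  rw [← ENNReal.ofReal_one]
  exact ENNReal.ofReal_le_ofReal (by linarith)

/-- With as many hops as there are vertices, no additional edges are needed. -/
theorem HasIntegerWeights.exists_empty_hopset [Fintype V] (hG : G.HasIntegerWeights W) {β ε : ℝ}
    (hε : 0 < ε) (hβ : (Fintype.card V : ℝ) - 1 ≤ β) :
    ∃ H : WeightedDigraph V, G.IsHopset H β ε ∧ H.edgeSet.ncard = 0 := by
  refine ⟨G.shortcuts ∅, hG.isHopset_shortcuts fun u v huv => ?_, ?_⟩
  · obtain ⟨k, hk, hgeo⟩ := hG.exists_geo_lt_card huv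
    have hk' : (k : ℝ) + 1 ≤ Fintype.card V := by exact_mod_cast hk
    exact ⟨k, by linarith, hgeo.within.mono Set.subset_union_left le_rfl
      (le_ofReal_one_add_mul hε _)⟩
  · simpa using ncard_edgeSet_shortcuts_le G ∅

theorem HasIntegerWeights.exists_hopset_of_sampling [Fintype V] (hG : G.HasIntegerWeights W)
    (hW : 1 ≤ W) (hV : 0 < Fintype.card V) {β β' ε : ℝ} (hε : 0 < ε) (hε1 : ε < 1) {b : ℕ}
    (hb : 0 < b) (hβ' : 16 * (1 + Real.log (Fintype.card V)) ≤ β') (hβ : b * (β' + 2) ≤ β) :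
    ∃ (m : ℕ) (H : WeightedDigraph V), m ≤ Fintype.card V ∧
      (m : ℝ) ≤ 2 * (1 + Real.log (Fintype.card V)) * Fintype.card V / b ∧
      (H.edgeSet.ncard : ℝ) ≤ (2 + 2 * Real.log (Fintype.card V * W)) *
        (40000000 * ((m : ℝ) ^ 2 * (1 + Real.log (Fintype.card V)) ^ 5 / (ε / 2 * β' ^ 3) +
          m * (1 + Real.log (Fintype.card V)) ^ 3)) ∧
      G.IsHopset H β ε := by
  classical
  obtain ⟨m, H, hm1, hm2, hHc, hH⟩ := exists_links_of_sampling hG.isQuasiMetric G.tightEdges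
    (fun u v huv => hG.exists_geo huv) (fun u v huv => hG.one_le_dist huv)
    (D := Fintype.card V * W) (by positivity) (fun u v huv => hG.dist_le huv) hε hε1 hb hβ'
  refine ⟨m, G.shortcuts H, hm1, hm2, ?_, hG.isHopset_shortcuts fun u v huv => ?_⟩
  · push_cast at hHc
    exact le_trans (by exact_mod_cast ncard_edgeSet_shortcuts_le G H) hHc
  · obtain ⟨k, hk, hw⟩ := hH u v huv
    exact ⟨k, hk.trans hβ, hw⟩

theorem HasIntegerWeights.exists_complete_hopset [Fintype V] (hG : G.HasIntegerWeights W)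
    {β ε : ℝ} (hε : 0 < ε) {b : ℕ} (hb : 0 < b) (hβ : 2 * (b : ℝ) + 1 ≤ β) :
    ∃ (m : ℕ) (H : WeightedDigraph V), m ≤ Fintype.card V ∧
      (m : ℝ) ≤ 2 * (1 + Real.log (Fintype.card V)) * Fintype.card V / b ∧
      (H.edgeSet.ncard : ℝ) ≤ (m : ℝ) ^ 2 ∧ G.IsHopset H β ε := by
  classical
  obtain ⟨m, H, hm1, hm2, hHc, hH⟩ := exists_complete_links hG.isQuasiMetric G.tightEdges
    (fun u v huv => hG.exists_geo huv) hb
  refine ⟨m, G.shortcuts H, hm1, hm2, ?_, hG.isHopset_shortcuts fun u v huv => ?_⟩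
  · exact_mod_cast (ncard_edgeSet_shortcuts_le G H).trans hHc
  · exact ⟨_, by push_cast; exact hβ,
      (hH u v huv).mono subset_rfl le_rfl (le_ofReal_one_add_mul hε _)⟩

end WeightedDigraph

/-! ### Numerical size estimates. -/

section Estimates

variable {n ℓ w ε β m : ℝ}

theorem log_factor_le (hℓ : 1 / 2 ≤ ℓ) (hw : ℓ ≤ w) : 2 + 2 * w ≤ 12 * w ^ 2 := by
  nlinarith

theorem pow_five_le (hℓ : 1 / 2 ≤ ℓ) : ℓ ^ 5 ≤ 4 * ℓ ^ 7 := by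
  have h0 : 0 ≤ ℓ ^ 5 := by positivity
  have h1 : 1 ≤ 4 * ℓ ^ 2 := by nlinarith
  calc ℓ ^ 5 = ℓ ^ 5 * 1 := by ring
    _ ≤ ℓ ^ 5 * (4 * ℓ ^ 2) := by gcongr
    _ = _ := by ring

theorem pow_three_le (hℓ : 1 / 2 ≤ ℓ) : ℓ ^ 3 ≤ 16 * ℓ ^ 7 := by
  have h0 : 0 ≤ ℓ ^ 3 := by positivity
  have h1 : 1 ≤ 4 * ℓ ^ 2 := by nlinarith
  calc ℓ ^ 3 = ℓ ^ 3 * (1 * 1) := by ring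
    _ ≤ ℓ ^ 3 * ((4 * ℓ ^ 2) * (4 * ℓ ^ 2)) := by gcongr
    _ = _ := by ring

/-- The assumption `β ^ 3 ≤ n` absorbs the additive `m` into `n² / β³`. Factors `ℓ²`, `w` and `1 /
ε` of the target are slack. -/
theorem size_le_of_small_hops (hℓ : 1 / 2 ≤ ℓ) (hw : ℓ ≤ w) (hε : 0 < ε) (hε1 : ε < 1)
    (hβ : 0 < β) (hβn : β ^ 3 ≤ n) (hm0 : 0 ≤ m) (hm : m ≤ n) :
    (2 + 2 * w) * (40000000 * (m ^ 2 * (1 + ℓ) ^ 5 / (ε / 2 * (β / 2) ^ 3) +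
      m * (1 + ℓ) ^ 3)) ≤ 10 ^ 15 * (n ^ 2 * ℓ ^ 7 * w ^ 2 / (ε ^ 2 * β ^ 3)) := by
  have hℓ0 : 0 < ℓ := by linarith
  have hw0 : 0 < w := by linarith
  have hn0 : 0 < n := lt_of_lt_of_le (by positivity) hβn
  have hΛ : 1 + ℓ ≤ 3 * ℓ := by linarith
  set Q := n ^ 2 / (ε ^ 2 * β ^ 3) with hQ
  have hQ0 : 0 < Q := by positivity
  have hεε : ε ^ 2 ≤ ε := by nlinarith
  have h1 : m ^ 2 / (ε / 2 * (β / 2) ^ 3) ≤ 16 * Q := by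
    calc m ^ 2 / (ε / 2 * (β / 2) ^ 3) = 16 * (m ^ 2 / (ε * β ^ 3)) := by field_simp; norm_num
      _ ≤ 16 * (n ^ 2 / (ε ^ 2 * β ^ 3)) := by gcongr
  have h2 : m ≤ Q := by
    refine hm.trans ?_
    rw [hQ, le_div_iff₀ (by positivity)]
    calc n * (ε ^ 2 * β ^ 3) ≤ n * (1 * n) := by gcongr; nlinarith
      _ = _ := by ring
  have h3 : m ^ 2 * (1 + ℓ) ^ 5 / (ε / 2 * (β / 2) ^ 3) ≤ 16 * Q * (243 * (4 * ℓ ^ 7)) := by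
    calc m ^ 2 * (1 + ℓ) ^ 5 / (ε / 2 * (β / 2) ^ 3)
        = m ^ 2 / (ε / 2 * (β / 2) ^ 3) * (1 + ℓ) ^ 5 := by ring
      _ ≤ 16 * Q * (3 * ℓ) ^ 5 := by gcongr
      _ = 16 * Q * (243 * ℓ ^ 5) := by ring
      _ ≤ _ := by gcongr; exact pow_five_le hℓ
  have h4 : m * (1 + ℓ) ^ 3 ≤ Q * (27 * (16 * ℓ ^ 7)) := by
    calc m * (1 + ℓ) ^ 3 ≤ Q * (3 * ℓ) ^ 3 := by gcongr
      _ = Q * (27 * ℓ ^ 3) := by ring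
      _ ≤ _ := by gcongr; exact pow_three_le hℓ
  have hR : 0 ≤ Q * ℓ ^ 7 * w ^ 2 := by positivity
  calc _ ≤ (12 * w ^ 2) * (40000000 * (16 * Q * (243 * (4 * ℓ ^ 7)) +
        Q * (27 * (16 * ℓ ^ 7)))) := by
        gcongr
        exact log_factor_le hℓ hw
    _ = 7672320000000 * (Q * ℓ ^ 7 * w ^ 2) := by ring
    _ ≤ 10 ^ 15 * (Q * ℓ ^ 7 * w ^ 2) := by gcongr; norm_num
    _ = _ := by rw [hQ]; ring

theorem pow_three_le_pow_seven_mul (hℓ : 1 / 2 ≤ ℓ) (hw : ℓ ≤ w) (hε : 0 < ε) (hε1 : ε < 1) :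
    ℓ ^ 3 ≤ 64 * (ℓ ^ 7 * w ^ 2 / ε ^ 2) := by
  have hℓ0 : 0 < ℓ := by linarith
  have h1 : 1 ≤ 4 * w ^ 2 := by nlinarith
  have h2 : w ^ 2 ≤ w ^ 2 / ε ^ 2 :=
    le_div_self (sq_nonneg w) (by positivity) (pow_le_one₀ hε.le hε1.le)
  calc ℓ ^ 3 = ℓ ^ 3 * 1 := by ring
    _ ≤ (16 * ℓ ^ 7) * (4 * (w ^ 2 / ε ^ 2)) := by
        gcongr
        · exact pow_three_le hℓ
        · linarith
    _ = _ := by ring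

theorem size_le_of_logarithmic_hops (hℓ : 1 / 2 ≤ ℓ) (hw : ℓ ≤ w) (hε : 0 < ε) (hε1 : ε < 1)
    (hβ : 0 < β) (hβℓ : β ≤ 100 * ℓ) (hm0 : 0 ≤ m) (hm : m ≤ n) :
    m ^ 2 ≤ 10 ^ 15 * (n ^ 2 * ℓ ^ 7 * w ^ 2 / (ε ^ 2 * β ^ 3)) := by
  have hℓ0 : 0 < ℓ := by linarith
  have h2 : β ^ 3 ≤ 10 ^ 15 * (ℓ ^ 7 * w ^ 2 / ε ^ 2) := by
    have h3 : 0 ≤ ℓ ^ 7 * w ^ 2 / ε ^ 2 := by positivity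
    calc β ^ 3 ≤ (100 * ℓ) ^ 3 := by gcongr
      _ = 1000000 * ℓ ^ 3 := by ring
      _ ≤ 1000000 * (64 * (ℓ ^ 7 * w ^ 2 / ε ^ 2)) := by
          gcongr; exact pow_three_le_pow_seven_mul hℓ hw hε hε1
      _ ≤ _ := by linarith
  calc m ^ 2 ≤ n ^ 2 * (β ^ 3 / β ^ 3) := by
        rw [div_self (by positivity), mul_one]; gcongr
    _ ≤ n ^ 2 * (10 ^ 15 * (ℓ ^ 7 * w ^ 2 / ε ^ 2) / β ^ 3) := by gcongr
    _ = _ := by field_simp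

/-- With `m` of order `ℓ * x³` and `β'` at least of order `x`, the main term is `ℓ² * x³ * ℓ⁵`; this
is where `ℓ⁷` is really needed. -/
theorem size_le_of_sampling {x β' : ℝ} (hℓ : 1 / 2 ≤ ℓ) (hw : ℓ ≤ w) (hε : 0 < ε) (hε1 : ε < 1)
    (hx : 0 < x) (hβ' : x / 2 ≤ β') (hm0 : 0 ≤ m) (hm : m ≤ 12 * ℓ * x ^ 3) :
    (2 + 2 * w) * (40000000 * (m ^ 2 * (1 + ℓ) ^ 5 / (ε / 2 * β' ^ 3) +
      m * (1 + ℓ) ^ 3)) ≤ 10 ^ 15 * (x ^ 3 * ℓ ^ 7 * w ^ 2 / ε ^ 2) := by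
  have hℓ0 : 0 < ℓ := by linarith
  have hw0 : 0 < w := by linarith
  have hΛ : 1 + ℓ ≤ 3 * ℓ := by linarith
  have hεε : ε ^ 2 ≤ ε := by nlinarith
  set Q := x ^ 3 / ε ^ 2 with hQ
  have hQ0 : 0 < Q := by positivity
  have h3 : m ^ 2 * (1 + ℓ) ^ 5 / (ε / 2 * β' ^ 3) ≤ 559872 * (Q * ℓ ^ 7) := by
    calc m ^ 2 * (1 + ℓ) ^ 5 / (ε / 2 * β' ^ 3)
        ≤ (12 * ℓ * x ^ 3) ^ 2 * (3 * ℓ) ^ 5 / (ε ^ 2 / 2 * (x / 2) ^ 3) := by gcongr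
      _ = _ := by rw [hQ]; field_simp; norm_num
  have h5 : x ^ 3 ≤ Q := by
    rw [hQ, le_div_iff₀ (by positivity)]
    have : ε ^ 2 ≤ 1 := by linarith
    have h6 : 0 ≤ x ^ 3 := by positivity
    nlinarith
  have h4 : m * (1 + ℓ) ^ 3 ≤ 2592 * (Q * ℓ ^ 7) := by
    have h7 : ℓ ^ 4 ≤ 8 * ℓ ^ 7 := by
      have h8 : 1 ≤ 8 * ℓ ^ 3 := by
        have : (1 / 2 : ℝ) ^ 3 ≤ ℓ ^ 3 := by gcongr
        linarith
      calc ℓ ^ 4 = ℓ ^ 4 * 1 := by ring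
        _ ≤ ℓ ^ 4 * (8 * ℓ ^ 3) := by gcongr
        _ = _ := by ring
    calc m * (1 + ℓ) ^ 3 ≤ (12 * ℓ * x ^ 3) * (3 * ℓ) ^ 3 := by gcongr
      _ = 324 * (x ^ 3 * ℓ ^ 4) := by ring
      _ ≤ 324 * (Q * (8 * ℓ ^ 7)) := by gcongr
      _ = _ := by ring
  have hR : 0 ≤ Q * ℓ ^ 7 * w ^ 2 := by positivity
  calc _ ≤ (12 * w ^ 2) * (40000000 * (559872 * (Q * ℓ ^ 7) + 2592 * (Q * ℓ ^ 7))) := by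
        have : 0 ≤ β' := by linarith
        gcongr
        exact log_factor_le hℓ hw
    _ = 269982720000000 * (Q * ℓ ^ 7 * w ^ 2) := by ring
    _ ≤ 10 ^ 15 * (Q * ℓ ^ 7 * w ^ 2) := by gcongr; norm_num
    _ = _ := by rw [hQ]; ring

theorem size_le_of_complete_sampling {x : ℝ} (hℓ : 1 / 2 ≤ ℓ) (hw : ℓ ≤ w) (hε : 0 < ε)
    (hε1 : ε < 1) (hx : 0 < x) (hxℓ : x ≤ 96 * ℓ) (hm0 : 0 ≤ m) (hm : m ≤ 48 * ℓ * x ^ 2) :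
    m ^ 2 ≤ 10 ^ 15 * (x ^ 3 * ℓ ^ 7 * w ^ 2 / ε ^ 2) := by
  have hℓ0 : 0 < ℓ := by linarith
  have h0 : 0 ≤ x ^ 3 * ℓ ^ 7 * w ^ 2 / ε ^ 2 := by positivity
  calc m ^ 2 ≤ (48 * ℓ * x ^ 2) ^ 2 := by gcongr
    _ = 2304 * ℓ ^ 2 * x ^ 3 * x := by ring
    _ ≤ 2304 * ℓ ^ 2 * x ^ 3 * (96 * ℓ) := by gcongr
    _ = 221184 * x ^ 3 * ℓ ^ 3 := by ring
    _ ≤ 221184 * x ^ 3 * (64 * (ℓ ^ 7 * w ^ 2 / ε ^ 2)) := by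
        gcongr; exact pow_three_le_pow_seven_mul hℓ hw hε hε1
    _ = 14155776 * (x ^ 3 * ℓ ^ 7 * w ^ 2 / ε ^ 2) := by ring
    _ ≤ _ := by gcongr; norm_num

end Estimates

/-! ### The two ranges of the hop bound. -/

namespace WeightedDigraph

variable {V : Type*} [Fintype V] {G : WeightedDigraph V} {W : ℕ}

theorem half_le_log {n : ℕ} (hn : 2 ≤ n) : 1 / 2 ≤ Real.log n := by
  have h1 : Real.log 2 ≤ Real.log n := Real.log_le_log (by norm_num) (by exact_mod_cast hn)
  have := Real.log_two_gt_d9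
  linarith

theorem log_le_log_mul {n W : ℕ} (hn : 2 ≤ n) (hW : 1 ≤ W) :
    Real.log n ≤ Real.log (n * W) := by
  have h0 : (0 : ℝ) < n := by positivity
  have h1 : (1 : ℝ) ≤ W := by exact_mod_cast hW
  exact Real.log_le_log h0 (le_mul_of_one_le_right h0.le h1)

theorem HasIntegerWeights.exists_hopset_of_le (hG : G.HasIntegerWeights W) (hW : 1 ≤ W)
    (hV : 2 ≤ Fintype.card V) {β ε : ℝ} (hε : 0 < ε) (hε1 : ε < 1)
    (hβ : 20 * Real.log (Fintype.card V) ≤ β) (hβn : β ^ 3 ≤ Fintype.card V) :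
    ∃ H : WeightedDigraph V, G.IsHopset H β ε ∧ (H.edgeSet.ncard : ℝ) ≤
      10 ^ 15 * ((Fintype.card V : ℝ) ^ 2 * Real.log (Fintype.card V) ^ 7 *
        Real.log (Fintype.card V * W) ^ 2 / (ε ^ 2 * β ^ 3)) := by
  have hℓ := half_le_log hV
  have hw := log_le_log_mul hV hW
  set ℓ := Real.log (Fintype.card V) with hℓdef
  have hβ0 : 0 < β := by linarith
  -- Above `100 * ℓ` the halved bound `β / 2` still exceeds `16 * (1 + ℓ)`, as `ℓ ≥ 1 / 2`. Below,
  -- `β` is so small that `n²` links are allowed.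
  by_cases h100 : β ≤ 100 * ℓ
  · obtain ⟨m, H, hm, -, hH, hop⟩ := hG.exists_complete_hopset (β := β) (b := 1) hε one_pos
      (by push_cast; linarith)
    exact ⟨H, hop, hH.trans (size_le_of_logarithmic_hops hℓ hw hε hε1 hβ0 h100
      (Nat.cast_nonneg m) (by exact_mod_cast hm))⟩
  · rw [not_le] at h100
    obtain ⟨m, H, hm, -, hH, hop⟩ := hG.exists_hopset_of_sampling (β := β) (β' := β / 2) hW
      (by omega) hε hε1 one_pos (by rw [← hℓdef]; linarith) (by push_cast; linarith)
    exact ⟨H, hop, hH.trans (size_le_of_small_hops hℓ hw hε hε1 hβ0 hβn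
      (Nat.cast_nonneg m) (by exact_mod_cast hm))⟩

theorem HasIntegerWeights.exists_hopset_of_lt (hG : G.HasIntegerWeights W) (hW : 1 ≤ W)
    (hV : 2 ≤ Fintype.card V) {β ε : ℝ} (hε : 0 < ε) (hε1 : ε < 1)
    (hβ : 20 * Real.log (Fintype.card V) ≤ β) (hβn : (Fintype.card V : ℝ) < β ^ 3) :
    ∃ H : WeightedDigraph V, G.IsHopset H β ε ∧ (H.edgeSet.ncard : ℝ) ≤
      10 ^ 15 * ((Fintype.card V : ℝ) ^ (3 / 2 : ℝ) * Real.log (Fintype.card V) ^ 7 *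
        Real.log (Fintype.card V * W) ^ 2 / (ε ^ 2 * β ^ (3 / 2 : ℝ))) := by
  have hℓ := half_le_log hV
  have hw := log_le_log_mul hV hW
  set n := Fintype.card V with hn
  set ℓ := Real.log n with hℓdef
  set w := Real.log (n * W) with hwdef
  have hn0 : (0 : ℝ) < n := by positivity
  have hβ0 : 0 < β := by linarith
  have hℓ0 : 0 < ℓ := by linarith
  have hw0 : 0 < w := by linarith
  by_cases hlarge : (n : ℝ) ≤ β
  · obtain ⟨H, hop, hH⟩ := hG.exists_empty_hopset (β := β) hε (by rw [← hn]; linarith)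
    refine ⟨H, hop, ?_⟩
    rw [hH, Nat.cast_zero]
    positivity
  rw [not_le] at hlarge
  -- With `b` about `β / x` the sample has about `ℓ * n * x / β = ℓ * x³` points, and the hop bound
  -- left for it is of order `x`. Up to logarithms this is the cube-root balance, and `x³ = (n / β)
  -- ^ (3 / 2)` is the target.
  set x := Real.sqrt (n / β) with hx
  have hx2 : x ^ 2 = n / β := Real.sq_sqrt (by positivity)
  have hx2' : (n : ℝ) = β * x ^ 2 := by rw [hx2]; field_simp
  have hx0 : 0 < x := Real.sqrt_pos.2 (by positivity)
  have htarget : (n : ℝ) ^ (3 / 2 : ℝ) * ℓ ^ 7 * w ^ 2 / (ε ^ 2 * β ^ (3 / 2 : ℝ)) =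
      x ^ 3 * ℓ ^ 7 * w ^ 2 / ε ^ 2 := by
    have h1 : (x ^ 2) ^ (3 / 2 : ℝ) = x ^ 3 := by
      rw [← Real.rpow_natCast x 2, ← Real.rpow_mul hx0.le, ← Real.rpow_natCast x 3]
      norm_num
    rw [hx2', Real.mul_rpow hβ0.le (by positivity), h1]
    field_simp
  rw [htarget]
  -- For small `x` the hop bound left for the sample might miss the threshold `16 * (1 + ℓ)`, so all
  -- sample pairs are linked directly.
  by_cases hxs : x ≤ 96 * ℓ
  · set b := ⌊β / 4⌋₊ with hb
    have hb1 : (1 : ℝ) ≤ β / 4 := by linarith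
    have hb0 : 0 < b := Nat.floor_pos.2 hb1
    have hb0' : (1 : ℝ) ≤ b := by exact_mod_cast hb0
    have hb2 : (b : ℝ) ≤ β / 4 := Nat.floor_le (by linarith)
    have hb3 : β / 8 ≤ b := by
      have := Nat.lt_floor_add_one (β / 4)
      rw [← hb] at this
      linarith
    obtain ⟨m, H, -, hm, hH, hop⟩ := hG.exists_complete_hopset (β := β) hε hb0 (by linarith)
    refine ⟨H, hop, hH.trans (size_le_of_complete_sampling hℓ hw hε hε1 hx0 hxs
      (Nat.cast_nonneg m) (hm.trans ?_))⟩
    calc 2 * (1 + ℓ) * n / b ≤ 2 * (3 * ℓ) * n / (β / 8) := by gcongr; linarith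
      _ = 48 * ℓ * x ^ 2 := by rw [hx2]; field_simp; norm_num
  · rw [not_le] at hxs
    have hx48 : 48 ≤ x := by linarith
    set b := ⌊β / x⌋₊ with hb
    -- `x ≤ β` is exactly the assumption `n ≤ β ^ 3`.
    have hb1 : (1 : ℝ) ≤ β / x := by
      rw [le_div_iff₀ hx0, one_mul]
      refine Real.sqrt_le_iff.2 ⟨hβ0.le, ?_⟩
      rw [div_le_iff₀ hβ0, ← pow_succ]
      exact hβn.le
    have hb0 : 0 < b := Nat.floor_pos.2 hb1
    have hb0' : (1 : ℝ) ≤ b := by exact_mod_cast hb0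
    have hb2 : (b : ℝ) ≤ β / x := Nat.floor_le (by linarith)
    have hb3 : β / (2 * x) ≤ b := by
      have h1 := Nat.lt_floor_add_one (β / x)
      have h2 : β / (2 * x) = β / x / 2 := by field_simp
      rw [← hb] at h1
      linarith
    have hβ' : x / 2 ≤ β / (2 * b) := by
      rw [le_div_iff₀ (by positivity)]
      have := (le_div_iff₀ hx0).1 hb2
      linarith
    have hhops : (b : ℝ) * (β / (2 * b) + 2) ≤ β := by
      have h1 : (b : ℝ) * (β / (2 * b) + 2) = β / 2 + 2 * b := by field_simp
      have h2 : β / x ≤ β / 48 := by gcongr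
      rw [h1]
      linarith
    obtain ⟨m, H, -, hm, hH, hop⟩ := hG.exists_hopset_of_sampling (β := β) (β' := β / (2 * b)) hW
      (by omega) hε hε1 hb0 (by rw [← hn, ← hℓdef]; linarith) hhops
    refine ⟨H, hop, hH.trans (size_le_of_sampling hℓ hw hε hε1 hx0 hβ'
      (Nat.cast_nonneg m) (hm.trans ?_))⟩
    calc 2 * (1 + ℓ) * n / b ≤ 2 * (3 * ℓ) * n / (β / (2 * x)) := by gcongr; linarith
      _ = 12 * ℓ * x * x ^ 2 := by rw [hx2]; field_simp; norm_num
      _ = _ := by ring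

end WeightedDigraph

/-! ### The main theorem. -/

theorem theorem1 :
    ∃ C : ℝ, 0 < C ∧
      ∀ (V : Type*) [Fintype V] (G : WeightedDigraph V) (n W : ℕ) (ε : ℝ),
        n = Fintype.card V → 1 ≤ W → G.HasIntegerWeights W → 0 < ε → ε < 1 →
        (∀ β : ℝ, 20 * Real.log n ≤ β →
          ∃ H : WeightedDigraph V, G.IsHopset H β ε ∧
            (β ≤ (n : ℝ) ^ (1 / 3 : ℝ) →
              (H.edgeSet.ncard : ℝ) ≤
                C * ((n : ℝ) ^ 2 * Real.log n ^ 7 * Real.log (n * W) ^ 2 / (ε ^ 2 * β ^ 3))) ∧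
            ((n : ℝ) ^ (1 / 3 : ℝ) < β →
              (H.edgeSet.ncard : ℝ) ≤
                C * ((n : ℝ) ^ (3 / 2 : ℝ) * Real.log n ^ 7 * Real.log (n * W) ^ 2 /
                  (ε ^ 2 * β ^ (3 / 2 : ℝ))))) ∧
        (∃ H : WeightedDigraph V,
          G.IsHopset H
            (C * ((n : ℝ) ^ (1 / 3 : ℝ) * Real.log n ^ (14 / 3 : ℝ) *
              Real.log (n * W) ^ (4 / 3 : ℝ) / ε ^ (4 / 3 : ℝ))) ε ∧
          (H.edgeSet.ncard : ℝ) ≤ C * n) := by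
  refine ⟨10 ^ 15, by norm_num, fun V _ G n W ε hn hW hG hε hε1 => ?_⟩
  subst hn
  rcases Nat.lt_or_ge (Fintype.card V) 2 with hV | hV
  -- With at most one vertex no links are needed, so the bounds only have to be nonnegative, even if
  -- `β = 0`, where division gives `0`.
  · have hcard : (Fintype.card V : ℝ) ≤ 1 := by exact_mod_cast Nat.lt_succ_iff.1 hV
    have hlog := Real.log_natCast_nonneg (Fintype.card V)
    have hlogW : 0 ≤ Real.log (Fintype.card V * W) := by
      have := Real.log_natCast_nonneg (Fintype.card V * W)
      rwa [Nat.cast_mul] at this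
    refine ⟨fun β hβ => ?_, ?_⟩
    · have hβ0 : 0 ≤ β := by linarith
      obtain ⟨H, hop, hH⟩ := hG.exists_empty_hopset (β := β) hε (by linarith)
      refine ⟨H, hop, fun _ => ?_, fun _ => ?_⟩
      · rw [hH, Nat.cast_zero]; positivity
      · rw [hH, Nat.cast_zero]; positivity
    · obtain ⟨H, hop, hH⟩ := hG.exists_empty_hopset (ε := ε)
        (β := 10 ^ 15 * ((Fintype.card V : ℝ) ^ (1 / 3 : ℝ) *
          Real.log (Fintype.card V) ^ (14 / 3 : ℝ) *
            Real.log (Fintype.card V * W) ^ (4 / 3 : ℝ) / ε ^ (4 / 3 : ℝ))) hε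
        (le_trans (by linarith) (by positivity : (0 : ℝ) ≤ _))
      refine ⟨H, hop, ?_⟩
      rw [hH, Nat.cast_zero]
      positivity
  set n := Fintype.card V with hn
  have hn0 : (0 : ℝ) < n := by positivity
  have hℓ := WeightedDigraph.half_le_log hV
  have hw := WeightedDigraph.log_le_log_mul hV hW
  have hcube : ((n : ℝ) ^ (1 / 3 : ℝ)) ^ 3 = n := by
    rw [← Real.rpow_natCast, ← Real.rpow_mul hn0.le]
    norm_num
  have hr0 : 0 ≤ (n : ℝ) ^ (1 / 3 : ℝ) := by positivity
  have hcube_lt : ∀ β : ℝ, (n : ℝ) ^ (1 / 3 : ℝ) < β → (n : ℝ) < β ^ 3 := by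
    intro β h
    calc (n : ℝ) = ((n : ℝ) ^ (1 / 3 : ℝ)) ^ 3 := hcube.symm
      _ < β ^ 3 := by gcongr
  refine ⟨fun β hβ => ?_, ?_⟩
  · rcases le_or_gt β ((n : ℝ) ^ (1 / 3 : ℝ)) with h | h
    · have hβ0 : 0 ≤ β := by linarith
      obtain ⟨H, hop, hH⟩ := hG.exists_hopset_of_le hW hV hε hε1 hβ
        ((pow_le_pow_left₀ hβ0 h 3).trans hcube.le)
      exact ⟨H, hop, fun _ => hH, fun h' => absurd h' (not_lt.2 h)⟩
    · obtain ⟨H, hop, hH⟩ := hG.exists_hopset_of_lt hW hV hε hε1 hβ (hcube_lt β h)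
      exact ⟨H, hop, fun h' => absurd h (not_lt.2 h'), fun _ => hH⟩
  · set ℓ := Real.log n with hℓdef
    set w := Real.log (n * W) with hwdef
    have hℓ0 : 0 < ℓ := by linarith
    have hw0 : 0 < w := by linarith
    have hn1 : (1 : ℝ) ≤ n := by exact_mod_cast (by omega : 1 ≤ n)
    have hn13 : 1 ≤ (n : ℝ) ^ (1 / 3 : ℝ) := Real.one_le_rpow hn1 (by norm_num)
    set Q := ℓ ^ (14 / 3 : ℝ) * w ^ (4 / 3 : ℝ) / ε ^ (4 / 3 : ℝ) with hQ
    -- This makes the chosen `β` exceed both `n ^ (1 / 3)` and `20 * ℓ`, so the bound for large `β`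
    -- applies.
    have hQℓ : ℓ / 64 ≤ Q := by
      have h1 : ℓ * (1 / 16) ≤ ℓ ^ (14 / 3 : ℝ) := by
        rw [show (14 / 3 : ℝ) = 1 + 11 / 3 by norm_num, Real.rpow_add hℓ0, Real.rpow_one]
        gcongr
        calc (1 / 16 : ℝ) = (1 / 2 : ℝ) ^ (4 : ℝ) := by norm_num
          _ ≤ (1 / 2 : ℝ) ^ (11 / 3 : ℝ) :=
            Real.rpow_le_rpow_of_exponent_ge (by norm_num) (by norm_num) (by norm_num)
          _ ≤ ℓ ^ (11 / 3 : ℝ) := by gcongr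
      have h2 : 1 / 4 ≤ w ^ (4 / 3 : ℝ) := by
        calc (1 / 4 : ℝ) = (1 / 2 : ℝ) ^ (2 : ℝ) := by norm_num
          _ ≤ (1 / 2 : ℝ) ^ (4 / 3 : ℝ) :=
            Real.rpow_le_rpow_of_exponent_ge (by norm_num) (by norm_num) (by norm_num)
          _ ≤ w ^ (4 / 3 : ℝ) := by gcongr; exact hℓ.trans hw
      have h3 : ε ^ (4 / 3 : ℝ) ≤ 1 := Real.rpow_le_one hε.le hε1.le (by norm_num)
      rw [hQ, le_div_iff₀ (by positivity)]
      calc ℓ / 64 * ε ^ (4 / 3 : ℝ) ≤ ℓ / 64 * 1 := by gcongr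
        _ = (ℓ * (1 / 16)) * (1 / 4) := by ring
        _ ≤ _ := by gcongr
    have hβeq : 10 ^ 15 * ((n : ℝ) ^ (1 / 3 : ℝ) * ℓ ^ (14 / 3 : ℝ) * w ^ (4 / 3 : ℝ) /
        ε ^ (4 / 3 : ℝ)) = 10 ^ 15 * (n : ℝ) ^ (1 / 3 : ℝ) * Q := by
      rw [hQ]; ring
    rw [hβeq]
    set β := 10 ^ 15 * (n : ℝ) ^ (1 / 3 : ℝ) * Q with hβ
    have hQ0 : 0 < Q := by linarith
    have hβ0 : 0 < β := by positivity
    have hβ1 : (n : ℝ) ^ (1 / 3 : ℝ) < β := by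
      have h1 : (n : ℝ) ^ (1 / 3 : ℝ) * 1 < (n : ℝ) ^ (1 / 3 : ℝ) * (10 ^ 15 * Q) := by
        gcongr
        linarith
      linarith
    have hβ2 : 20 * ℓ ≤ β := by
      calc 20 * ℓ ≤ 10 ^ 15 * 1 * (ℓ / 64) := by linarith
        _ ≤ β := by rw [hβ]; gcongr
    obtain ⟨H, hop, hH⟩ := hG.exists_hopset_of_lt hW hV hε hε1 hβ2 (hcube_lt β hβ1)
    refine ⟨H, hop, hH.trans ?_⟩
    gcongr
    have hpow : ∀ {x a : ℝ}, 0 < x → (x ^ a) ^ (3 / 2 : ℝ) = x ^ (a * (3 / 2)) :=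
      fun {x a} hx => (Real.rpow_mul hx.le _ _).symm
    -- The exponents `14/3`, `4/3`, `4/3` become `7`, `2`, `2`, cancelling every logarithm and `ε`
    -- in the size bound.
    have hβ32 : β ^ (3 / 2 : ℝ) =
        (10 ^ 15 : ℝ) ^ (3 / 2 : ℝ) * (n : ℝ) ^ (1 / 2 : ℝ) * (ℓ ^ 7 * w ^ 2 / ε ^ 2) := by
      rw [hβ, hQ, Real.mul_rpow (by positivity) (by positivity),
        Real.mul_rpow (by positivity) (by positivity),
        Real.div_rpow (by positivity) (by positivity),
        Real.mul_rpow (by positivity) (by positivity), hpow hn0, hpow hℓ0, hpow hw0, hpow hε,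
        ← Real.rpow_natCast ℓ 7, ← Real.rpow_natCast w 2, ← Real.rpow_natCast ε 2]
      norm_num
    have hC : 1 ≤ (10 ^ 15 : ℝ) ^ (3 / 2 : ℝ) := Real.one_le_rpow (by norm_num) (by norm_num)
    have hn32 : (n : ℝ) ^ (3 / 2 : ℝ) = n * (n : ℝ) ^ (1 / 2 : ℝ) := by
      rw [show (3 / 2 : ℝ) = 1 + 1 / 2 by norm_num, Real.rpow_add hn0, Real.rpow_one]
    rw [div_le_iff₀ (by positivity), hβ32, hn32]
    calc (n : ℝ) * (n : ℝ) ^ (1 / 2 : ℝ) * ℓ ^ 7 * w ^ 2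
        = n * (1 * ((n : ℝ) ^ (1 / 2 : ℝ) * ℓ ^ 7 * w ^ 2)) := by ring
      _ ≤ n * ((10 ^ 15 : ℝ) ^ (3 / 2 : ℝ) * ((n : ℝ) ^ (1 / 2 : ℝ) * ℓ ^ 7 * w ^ 2)) := by
          gcongr
      _ = _ := by field_simp
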